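/- Let $d\in\mathbb N$ and let $\mathcal S^d$ be the space of real symmetric $d\times d$ matrices with inner product $\langle A,B\rangle=\operatorname{tr}(AB)$. Identify $Q\in\mathcal S^d$ with the quadratic form $Q[x]=x^tQx$, and let $\mathcal S^d_{>0}\subset\mathcal S^d$ be the set of positive definite forms (PQFs). For $Q\in\mathcal S^d_{>0}$ let $$\lambda(Q)=\min_{v\in\mathbb Z^d\setminus\{0\}}Q[v],\qquad \mu(Q)=\max_{x\in\mathbb R^d}\min_{v\in\mathbb Z^d}Q[x-v],$$ $$\Theta(Q)=\sqrt{\mu(Q)^d/\det Q}\cdot\kappa_d,\qquad \gamma(Q)=2\sqrt{\mu(Q)/\lambda(Q)},$$ where $\kappa_d$ is the volume of the Euclidean unit ball. A PQF is a locally optimal solution to the lattice covering problem (lattice packing-covering problem) if it is a local minimum of $\Theta$ (of $\gamma$) on $\mathcal S^d_{>0}$. A Delone polytope of $Q$ is a polytope $\operatorname{conv}\{v_1,\dots,v_n\}$, $n\ge1$, $v_i\in\mathbb Z^d$, for which there are $c\in\mathbb R^d$, $r\in\mathbb R$ with $Q[v_i-c]=r^2$ for all $i$ and $Q[v-c]>r^2$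 for all $v\in\mathbb Z^d\setminus\{v_1,\dots,v_n\}$. The set $\operatorname{Del}(Q)$ of all Delone polytopes of $Q$ is its Delone subdivision; a Delone triangulation is a Delone subdivision $\mathcal D$ of some PQF which consists of simplices only. Let $\mathbf\Delta(\mathcal D)=\{Q\in\mathcal S^d_{>0}:\operatorname{Del}(Q)=\mathcal D\}$. For a $d$-dimensional simplex $L=\operatorname{conv}\{w_0,\dots,w_d\}$, put $v_i=w_i-w_0$ and let $\mathrm{BR}_L(Q)$ be the symmetric $(d+1)\times(d+1)$ matrix whose top left entry is $4$, whose remaining entries in the first row and in the first column are $v_i^tQv_i$ ($1\le i\le d$), and whose lower right $d\times d$ block is $(v_i^tQv_j)_{i,j}$; its determinant depends only on $L$ and $Q$. For a Delone triangulation $\mathcal D$ let $$\mathbf W_{\mathcal D}=\{Q\in\mathbf\Delta(\mathcal D):\det \mathrm{BR}_L(Q)\ge0\text{ for all }d\text{-dimensional }L\in\mathcal D\},$$ and for $Q\in\overline{\mathbf\Delta(\mathcal D)}$ let $$\mathcal C_{\mathcal D}(Q)=\{N\in\mathcal S^d:\langle N,S\rangle\le\langle N,Q\rangle\text{ for all }S\in\overline{\mathbf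 W_{\mathcal D}}\}$$ be the normal cone of $\overline{\mathbf W_{\mathcal D}}$ at $Q$. For $v\in\mathbb Z^d$ put $V_v=vv^t$, so that $\langle Q,V_v\rangle=Q[v]$. For $X\subset\mathcal S^d$ let $\operatorname{cone}X$ be the set of all finite linear combinations of elements of $X$ with nonnegative coefficients. **Proposition.** Let $Q\in\mathcal S^d_{>0}$ be a PQF with $\mu(Q)=1$. Below, the intersections run over all Delone triangulations $\mathcal D$ with $Q\in\overline{\mathbf\Delta(\mathcal D)}$. 1. $Q$ is a locally optimal solution to the lattice covering problem if and only if $$\operatorname{cone}\{Q^{-1}\}\cap\bigcap_{Q\in\overline{\mathbf\Delta(\mathcal D)}}\mathcal C_{\mathcal D}(Q)$$ contains a nonzero element. 2. $Q$ is a locally optimal solution to the lattice packing-covering problem if $$\operatorname{cone}\{V_v: v\in\mathbb Z^d\setminus\{0\},\ \langle Q,V_v\rangle=\lambda(Q)\}\cap\bigcap_{Q\in\overline{\mathbf\Delta(\mathcal D)}}\mathcal C_{\mathcal D}(Q)$$ contains a nonzero element. -/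

import Mathlib

namespace PQF

/-- The value `Q[x] = xᵗ Q x` of the quadratic form with symmetric matrix `Q`. -/
noncomputable def val {d : ℕ} (Q : Matrix (Fin d) (Fin d) ℝ) (x : Fin d → ℝ) : ℝ :=
  x ⬝ᵥ Q.mulVec x

/-- An integral vector, regarded as a real vector. -/
def toReal {d : ℕ} (v : Fin d → ℤ) : Fin d → ℝ := fun i => (v i : ℝ)

/-- The set of positive definite quadratic forms (symmetry is part of `Matrix.PosDef`). -/
def posForms (d : ℕ) : Set (Matrix (Fin d) (Fin d) ℝ) := {Q | Q.PosDef}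

/-- The homogeneous minimum `λ(Q)`. -/
noncomputable def homMin {d : ℕ} (Q : Matrix (Fin d) (Fin d) ℝ) : ℝ :=
  ⨅ v : {v : Fin d → ℤ // v ≠ 0}, val Q (toReal v.1)

/-- The inhomogeneous minimum `μ(Q)`. -/
noncomputable def inhomMin {d : ℕ} (Q : Matrix (Fin d) (Fin d) ℝ) : ℝ :=
  ⨆ x : Fin d → ℝ, ⨅ v : Fin d → ℤ, val Q (x - toReal v)

/-- The covering density `Θ(Q) = √(μ(Q)^d / det Q) · κ_d`, with `κ_d` the volume of the
Euclidean unit ball. -/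
noncomputable def coveringDensity {d : ℕ} (Q : Matrix (Fin d) (Fin d) ℝ) : ℝ :=
  Real.sqrt (inhomMin Q ^ d / Q.det) *
    (MeasureTheory.volume (Metric.closedBall (0 : EuclideanSpace ℝ (Fin d)) 1)).toReal

/-- The packing-covering constant `γ(Q) = 2 √(μ(Q) / λ(Q))`. -/
noncomputable def packingCoveringConstant {d : ℕ} (Q : Matrix (Fin d) (Fin d) ℝ) : ℝ :=
  2 * Real.sqrt (inhomMin Q / homMin Q)

/-- `Q` is a local minimum of `Θ` among positive definite forms. -/
def IsLocallyOptimalCovering {d : ℕ} (Q : Matrix (Fin d) (Fin d) ℝ) : Prop :=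
  IsLocalMinOn coveringDensity (posForms d) Q

/-- `Q` is a local minimum of `γ` among positive definite forms. -/
def IsLocallyOptimalPackingCovering {d : ℕ} (Q : Matrix (Fin d) (Fin d) ℝ) : Prop :=
  IsLocalMinOn packingCoveringConstant (posForms d) Q

/-- `L = conv {v₁, …, vₙ}` with integral `vᵢ` is a Delone polytope of `Q`: some sphere with respect
to `Q` passes through all the `vᵢ`, and all the other integral points lie strictly outside it.
Polytopes of all dimensions `0, …, d` are included. -/
def IsDelonePolytope {d : ℕ} (Q : Matrix (Fin d) (Fin d) ℝ) (L : Set (Fin d → ℝ)) : Prop :=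
  ∃ V : Finset (Fin d → ℤ), V.Nonempty ∧ L = convexHull ℝ (toReal '' (V : Set (Fin d → ℤ))) ∧
    ∃ (c : Fin d → ℝ) (r : ℝ),
      (∀ v ∈ V, val Q (toReal v - c) = r ^ 2) ∧ (∀ v ∉ V, r ^ 2 < val Q (toReal v - c))

/-- The Delone subdivision of `Q`. -/
def Del {d : ℕ} (Q : Matrix (Fin d) (Fin d) ℝ) : Set (Set (Fin d → ℝ)) :=
  {L | IsDelonePolytope Q L}

/-- A simplex of any dimension: the convex hull of an affinely independent finite family. -/
def IsSimplex {d : ℕ} (L : Set (Fin d → ℝ)) : Prop :=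
  ∃ (n : ℕ) (w : Fin (n + 1) → Fin d → ℝ),
    AffineIndependent ℝ w ∧ L = convexHull ℝ (Set.range w)

/-- A Delone triangulation: the Delone subdivision of some positive definite form,
consisting of simplices only. -/
def IsDeloneTriangulation {d : ℕ} (D : Set (Set (Fin d → ℝ))) : Prop :=
  (∃ Q ∈ posForms d, Del Q = D) ∧ ∀ L ∈ D, IsSimplex L

/-- The secondary cone `Δ(D)`. -/
def secondaryCone {d : ℕ} (D : Set (Set (Fin d → ℝ))) : Set (Matrix (Fin d) (Fin d) ℝ) :=
  {Q | Q ∈ posForms d ∧ Del Q = D}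

/-- The matrix `BR_L(Q)` of the simplex `L = conv {0, v₁, …, v_d}`: the top left entry is `4`, the
rest of the first row and column is `(vᵢ, vᵢ)`, and the lower right block is the Gram matrix
`(vᵢ, vⱼ)`, where `(x, y) = xᵗ Q y`. -/
noncomputable def BR {d : ℕ} (v : Fin d → Fin d → ℝ) (Q : Matrix (Fin d) (Fin d) ℝ) :
    Matrix (Unit ⊕ Fin d) (Unit ⊕ Fin d) ℝ :=
  Matrix.fromBlocks
    (Matrix.of fun _ _ => 4)
    (Matrix.of fun _ j => v j ⬝ᵥ Q.mulVec (v j))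
    (Matrix.of fun i _ => v i ⬝ᵥ Q.mulVec (v i))
    (Matrix.of fun i j => v i ⬝ᵥ Q.mulVec (v j))

/-- The set `V_L` of positive definite forms with `|BR_L(Q)| ≥ 0`, for a `d`-dimensional simplex
`L = conv {w₀, …, w_d}`, moved to the origin as `conv {0, w₁ - w₀, …, w_d - w₀}`. The determinant
does not depend on the order of the vertices. A simplex of dimension below `d` has no such family
`w`, and imposes no condition. -/
def circumradiusLeOne {d : ℕ} (L : Set (Fin d → ℝ)) : Set (Matrix (Fin d) (Fin d) ℝ) :=
  {Q | Q ∈ posForms d ∧ ∀ w : Fin (d + 1) → Fin d → ℝ,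
    AffineIndependent ℝ w → L = convexHull ℝ (Set.range w) →
      0 ≤ (BR (fun i => w i.succ - w 0) Q).det}

/-- The set `W_D = ⋂_{L ∈ D} V_L ∩ Δ(D)`. -/
def W {d : ℕ} (D : Set (Set (Fin d → ℝ))) : Set (Matrix (Fin d) (Fin d) ℝ) :=
  (⋂ L ∈ D, circumradiusLeOne L) ∩ secondaryCone D

/-- The trace inner product `⟨A, B⟩ = tr (A B)` of symmetric matrices. -/
noncomputable def ip {d : ℕ} (A B : Matrix (Fin d) (Fin d) ℝ) : ℝ := (A * B).trace

/-- The normal cone at `Q`, in the space of symmetric matrices, of a set `C` of symmetric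
matrices: all outer normal vectors of supporting hyperplanes of `C` at `Q`, and zero. -/
def normalCone {d : ℕ} (C : Set (Matrix (Fin d) (Fin d) ℝ)) (Q : Matrix (Fin d) (Fin d) ℝ) :
    Set (Matrix (Fin d) (Fin d) ℝ) :=
  {N | N.IsSymm ∧ ∀ S ∈ C, ip N S ≤ ip N Q}

/-- `C_D(Q)`, the normal cone at `Q` of the closure of `W_D`. -/
def deloneNormalCone {d : ℕ} (D : Set (Set (Fin d → ℝ))) (Q : Matrix (Fin d) (Fin d) ℝ) :
    Set (Matrix (Fin d) (Fin d) ℝ) :=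
  normalCone (closure (W D)) Q

/-- The intersection of the cones `C_D(Q)` over all Delone triangulations `D` for which `Q` lies in
the closure of `Δ(D)`. -/
def commonNormals {d : ℕ} (Q : Matrix (Fin d) (Fin d) ℝ) : Set (Matrix (Fin d) (Fin d) ℝ) :=
  ⋂ D ∈ {D : Set (Set (Fin d → ℝ)) | IsDeloneTriangulation D ∧ Q ∈ closure (secondaryCone D)},
    deloneNormalCone D Q

/-- `V_v = v vᵗ`, the symmetric matrix with `⟨Q', V_v⟩ = Q'[v]` for all symmetric `Q'`. -/
def vecForm {d : ℕ} (v : Fin d → ℤ) : Matrix (Fin d) (Fin d) ℝ :=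
  Matrix.vecMulVec (toReal v) (toReal v)

/-- The convex cone of all finite linear combinations of `X` with nonnegative coefficients. -/
def cone {d : ℕ} (X : Set (Matrix (Fin d) (Fin d) ℝ)) : Set (Matrix (Fin d) (Fin d) ℝ) :=
  (PointedCone.hull ℝ X : Set (Matrix (Fin d) (Fin d) ℝ))

end PQF

namespace PQF

open Matrix Filter Topology

variable {d : ℕ} {Q A B : Matrix (Fin d) (Fin d) ℝ}

/-! On the secondary cone of a triangulation D, `W D` is exactly the set of forms with μ ≤ 1
(`mem_W_iff`): det BR_L(Q) is a positive multiple of 4 − 4R², with R the circumradius of L, and μ(Q)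
is the largest R². On a secondary cone μ is quasiconvex (`inhomMin_add_le`). Every form P near Q
lies together with Q in the closure of the secondary cone of some triangulation D
(`eventually_exists_triangulation`), and then P/μ(P) lies in the closure of `W D`.

For covering, minimising Θ means maximising det subject to μ ≤ 1. If Q is optimal and S is in the
closure of `W D`, the segment from Q towards S keeps μ ≤ 1, so det cannot increase to first order:
⟨Q⁻¹, S⟩ ≤ d = ⟨Q⁻¹, Q⟩. Conversely, this inequality for S = P/μ(P) gives det S ≤ det Q by AM-GM,
that is, Θ(Q) ≤ Θ(P).

For packing-covering, a conic combination N of the V_v over minimal vectors, of total weight s > 0,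
satisfies ⟨N, Q⟩ = sλ(Q) and ⟨N, P⟩ ≥ sλ(P), so normality yields λ(P) ≤ μ(P)λ(Q).

Delone polytopes are handled through their vertex sets `nearest Q c`, or equivalently through affine
functions that touch the form from below on the integral vectors. -/

/-! ### Quadratic form identities and perturbation of positive definite forms -/

lemma dotProduct_mulVec_symm (hQ : Q.IsHermitian) (x y : Fin d → ℝ) :
    x ⬝ᵥ Q *ᵥ y = y ⬝ᵥ Q *ᵥ x := by
  have h : Qᵀ = Q := by simpa [Matrix.IsHermitian, conjTranspose_eq_transpose_of_trivial] using hQ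
  rw [dotProduct_mulVec, ← mulVec_transpose, h, dotProduct_comm]

lemma val_add (hQ : Q.IsHermitian) (x y : Fin d → ℝ) :
    val Q (x + y) = val Q x + 2 * (x ⬝ᵥ Q *ᵥ y) + val Q y := by
  simp only [val, mulVec_add, dotProduct_add, add_dotProduct]
  rw [dotProduct_mulVec_symm hQ y x]; ring

lemma val_sub (hQ : Q.IsHermitian) (x y : Fin d → ℝ) :
    val Q (x - y) = val Q x - 2 * (x ⬝ᵥ Q *ᵥ y) + val Q y := by
  simp only [val, mulVec_sub, dotProduct_sub, sub_dotProduct]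
  rw [dotProduct_mulVec_symm hQ y x]; ring

lemma val_smul (t : ℝ) (x : Fin d → ℝ) : val Q (t • x) = t ^ 2 * val Q x := by
  simp only [val, mulVec_smul, dotProduct_smul, smul_dotProduct, smul_eq_mul]; ring

lemma val_neg (x : Fin d → ℝ) : val Q (-x) = val Q x := by
  simpa using val_smul (Q := Q) (-1) x

lemma val_sub_comm (x y : Fin d → ℝ) : val Q (x - y) = val Q (y - x) := by
  rw [← val_neg, neg_sub]

lemma val_zero : val Q 0 = 0 := by simp [val]

lemma val_form_add (x : Fin d → ℝ) : val (A + B) x = val A x + val B x := by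
  simp [val, add_mulVec]

lemma val_form_sub (x : Fin d → ℝ) : val (A - B) x = val A x - val B x := by
  simp [val, sub_mulVec]

lemma val_form_smul (s : ℝ) (x : Fin d → ℝ) : val (s • A) x = s * val A x := by
  simp [val, smul_mulVec]

lemma posDef_iff_val : Q.PosDef ↔ Q.IsHermitian ∧ ∀ x, x ≠ 0 → 0 < val Q x := by
  simp [posDef_iff_dotProduct_mulVec, val]

lemma val_pos (hQ : Q.PosDef) {x : Fin d → ℝ} (hx : x ≠ 0) : 0 < val Q x :=
  (posDef_iff_val.1 hQ).2 x hx

lemma val_nonneg (hQ : Q.PosDef) (x : Fin d → ℝ) : 0 ≤ val Q x := by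
  rcases eq_or_ne x 0 with rfl | hx
  · simp [val]
  · exact (val_pos hQ hx).le

/-- The parallel axis theorem for a quadratic form. -/
lemma sum_mul_val_sub (hQ : Q.IsHermitian) {ι : Type*} (F : Finset ι) (a : ι → ℝ)
    (p : ι → Fin d → ℝ) (ha : ∑ i ∈ F, a i = 1) {x : Fin d → ℝ} (hx : ∑ i ∈ F, a i • p i = x)
    (c : Fin d → ℝ) :
    ∑ i ∈ F, a i * val Q (p i - c) = ∑ i ∈ F, a i * val Q (p i - x) + val Q (x - c) := by
  have h : ∀ i, a i * val Q (p i - c) = a i * val Q (p i - x)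
      + (2 * ((a i • p i) ⬝ᵥ Q *ᵥ (x - c)) - a i * (2 * (x ⬝ᵥ Q *ᵥ (x - c))))
      + a i * val Q (x - c) := by
    intro i
    have : p i - c = (p i - x) + (x - c) := by abel
    rw [this, val_add hQ, sub_dotProduct, smul_dotProduct, smul_eq_mul]; ring
  simp_rw [h, Finset.sum_add_distrib, Finset.sum_sub_distrib, ← Finset.mul_sum, ← Finset.sum_mul,
    ← sum_dotProduct, hx, ha]
  ring

lemma exists_mul_dotProduct_le_val (hQ : Q.PosDef) :
    ∃ a : ℝ, 0 < a ∧ ∀ x, a * (x ⬝ᵥ x) ≤ val Q x := by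
  have hc : Continuous (val Q) := by unfold val; fun_prop
  let S : Set (Fin d → ℝ) := {x | x ⬝ᵥ x = 1}
  have hS : IsCompact S := by
    refine Metric.isCompact_of_isClosed_isBounded ?_ ?_
    · exact isClosed_eq (by fun_prop) continuous_const
    · refine isBounded_iff_forall_norm_le.2 ⟨1, fun x hx => ?_⟩
      refine (pi_norm_le_iff_of_nonneg zero_le_one).2 fun i => ?_
      have : x i * x i ≤ x ⬝ᵥ x :=
        Finset.single_le_sum (f := fun i => x i * x i) (fun i _ => mul_self_nonneg _)
          (Finset.mem_univ i)
      rw [show x ⬝ᵥ x = 1 from hx] at this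
      rw [Real.norm_eq_abs, abs_le]
      constructor <;> nlinarith
  have key : ∃ a : ℝ, 0 < a ∧ ∀ x ∈ S, a ≤ val Q x := by
    rcases S.eq_empty_or_nonempty with h | h
    -- The unit sphere is empty when `d = 0`; any positive constant then works.
    · exact ⟨1, one_pos, by simp [h]⟩
    · obtain ⟨x, hx, hm⟩ := hS.exists_isMinOn h hc.continuousOn
      refine ⟨val Q x, val_pos hQ ?_, fun y hy => hm hy⟩
      rintro rfl
      simp [S] at hx
  obtain ⟨a, ha, h⟩ := key
  refine ⟨a, ha, fun x => ?_⟩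
  rcases eq_or_ne x 0 with rfl | hx
  · simp [val]
  have hp : 0 < x ⬝ᵥ x := lt_of_le_of_ne
    (Finset.sum_nonneg fun i _ => mul_self_nonneg _) (fun h => hx (dotProduct_self_eq_zero.1 h.symm))
  have hs := Real.sq_sqrt hp.le
  have hsp := Real.sqrt_pos.2 hp
  have h1 := h ((Real.sqrt (x ⬝ᵥ x))⁻¹ • x) (by
    simp only [S, Set.mem_ofPred_eq, smul_dotProduct, dotProduct_smul, smul_eq_mul]
    field_simp
    exact hs.symm)
  rw [val_smul, inv_pow, hs] at h1
  field_simp at h1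
  linarith

lemma abs_val_le (A : Matrix (Fin d) (Fin d) ℝ) (x : Fin d → ℝ) :
    |val A x| ≤ (∑ i, ∑ j, |A i j|) * (x ⬝ᵥ x) := by
  have hi : ∀ i, x i * x i ≤ x ⬝ᵥ x := fun i =>
    Finset.single_le_sum (f := fun i => x i * x i) (fun i _ => mul_self_nonneg _)
      (Finset.mem_univ i)
  have : val A x = ∑ i, ∑ j, A i j * (x i * x j) := by
    simp only [val, dotProduct, mulVec, Finset.mul_sum]
    exact Finset.sum_congr rfl fun i _ => Finset.sum_congr rfl fun j _ => by ring
  rw [this, Finset.sum_mul]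
  refine (Finset.abs_sum_le_sum_abs _ _).trans (Finset.sum_le_sum fun i _ => ?_)
  rw [Finset.sum_mul]
  refine (Finset.abs_sum_le_sum_abs _ _).trans (Finset.sum_le_sum fun j _ => ?_)
  rw [abs_mul]
  refine mul_le_mul_of_nonneg_left ?_ (abs_nonneg _)
  rw [abs_le]
  constructor <;> nlinarith [hi i, hi j, sq_nonneg (x i + x j), sq_nonneg (x i - x j)]

/-- Near a positive definite form, all forms are uniformly close to it in relative terms. -/
lemma eventually_abs_val_sub_le (hQ : Q.PosDef) {ε : ℝ} (hε : 0 < ε) :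
    ∀ᶠ Q' in 𝓝 Q, ∀ x, |val Q' x - val Q x| ≤ ε * val Q x := by
  obtain ⟨a, ha, h⟩ := exists_mul_dotProduct_le_val hQ
  have hc : Continuous fun Q' : Matrix (Fin d) (Fin d) ℝ => ∑ i, ∑ j, |(Q' - Q) i j| := by
    fun_prop
  have h0 : (fun Q' : Matrix (Fin d) (Fin d) ℝ => ∑ i, ∑ j, |(Q' - Q) i j|) Q < ε * a := by
    simpa using mul_pos hε ha
  filter_upwards [hc.continuousAt.eventually_lt_const h0] with Q' h' x
  rw [← val_form_sub]
  have hx : 0 ≤ x ⬝ᵥ x := Finset.sum_nonneg fun i _ => mul_self_nonneg _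
  calc _ ≤ _ := abs_val_le _ x
    _ ≤ ε * a * (x ⬝ᵥ x) := mul_le_mul_of_nonneg_right h'.le hx
    _ = ε * (a * (x ⬝ᵥ x)) := by ring
    _ ≤ _ := mul_le_mul_of_nonneg_left (h x) hε.le

lemma eventually_posDef (hQ : Q.PosDef) : ∀ᶠ Q' in 𝓝 Q, Q'.IsHermitian → Q'.PosDef := by
  filter_upwards [eventually_abs_val_sub_le hQ one_half_pos] with Q' h hs
  refine posDef_iff_val.2 ⟨hs, fun x hx => ?_⟩
  have := abs_le.1 (h x)
  linarith [val_pos hQ hx]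

/-! ### Nearest lattice vectors and the inhomogeneous minimum -/

/-- The integral vectors at smallest `Q`-distance from `c`. -/
def nearest (Q : Matrix (Fin d) (Fin d) ℝ) (c : Fin d → ℝ) : Set (Fin d → ℤ) :=
  {v | ∀ w, val Q (toReal v - c) ≤ val Q (toReal w - c)}

lemma toReal_injective : Function.Injective (toReal : (Fin d → ℤ) → Fin d → ℝ) := fun v w h => by
  ext i
  exact Int.cast_injective (congrFun h i)

lemma finite_setOf_dotProduct_le (R : ℝ) :
    {v : Fin d → ℤ | toReal v ⬝ᵥ toReal v ≤ R}.Finite := by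
  refine (Set.finite_Icc (fun _ : Fin d => -⌈R⌉) fun _ => ⌈R⌉).subset fun v hv => ?_
  have h : ∀ i, |v i| ≤ ⌈R⌉ := fun i => by
    have h1 : toReal v i * toReal v i ≤ toReal v ⬝ᵥ toReal v :=
      Finset.single_le_sum (f := fun i => toReal v i * toReal v i) (fun i _ => mul_self_nonneg _)
        (Finset.mem_univ i)
    have h2 : ((v i * v i : ℤ) : ℝ) ≤ ⌈R⌉ := by
      push_cast
      exact h1.trans (le_trans hv (Int.le_ceil R))
    have h3 : v i * v i ≤ ⌈R⌉ := by exact_mod_cast h2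
    have h4 : |v i| * |v i| = v i * v i := abs_mul_abs_self _
    rcases (abs_nonneg (v i)).eq_or_lt with h5 | h5 <;> nlinarith
  exact ⟨fun i => (abs_le.1 (h i)).1, fun i => (abs_le.1 (h i)).2⟩

lemma dotProduct_self_nonneg' (x : Fin d → ℝ) : 0 ≤ x ⬝ᵥ x :=
  Finset.sum_nonneg fun _ _ => mul_self_nonneg _

lemma dotProduct_self_le (x c : Fin d → ℝ) : x ⬝ᵥ x ≤ 2 * ((x - c) ⬝ᵥ (x - c)) + 2 * (c ⬝ᵥ c) := by
  have := dotProduct_self_nonneg' (x - (2 : ℝ) • c)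
  simp only [sub_dotProduct, dotProduct_sub, smul_dotProduct, dotProduct_smul, smul_eq_mul,
    dotProduct_comm c x] at *
  linarith

lemma finite_sublevel (hQ : Q.PosDef) (c : Fin d → ℝ) (t : ℝ) :
    {v : Fin d → ℤ | val Q (toReal v - c) ≤ t}.Finite := by
  obtain ⟨a, ha, h⟩ := exists_mul_dotProduct_le_val hQ
  refine (finite_setOf_dotProduct_le (2 * (t / a) + 2 * (c ⬝ᵥ c))).subset fun v hv => ?_
  refine (dotProduct_self_le (toReal v) c).trans ?_
  have : (toReal v - c) ⬝ᵥ (toReal v - c) ≤ t / a := by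
    rw [le_div_iff₀ ha, mul_comm]
    exact (h _).trans hv
  linarith

lemma nearest_finite (hQ : Q.PosDef) (c : Fin d → ℝ) : (nearest Q c).Finite :=
  (finite_sublevel hQ c (val Q (toReal 0 - c))).subset fun _ hv => hv 0

lemma nearest_nonempty (hQ : Q.PosDef) (c : Fin d → ℝ) : (nearest Q c).Nonempty := by
  obtain ⟨v, hv, h⟩ := Set.exists_min_image _ (fun v => val Q (toReal v - c))
    (finite_sublevel hQ c (val Q (toReal 0 - c))) ⟨0, le_refl (val Q (toReal 0 - c))⟩
  refine ⟨v, fun w => ?_⟩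
  by_cases hw : val Q (toReal w - c) ≤ val Q (toReal 0 - c)
  · exact h w hw
  · exact le_trans hv (not_le.1 hw).le

lemma val_eq_of_mem_nearest {c : Fin d → ℝ} {v w : Fin d → ℤ} (hv : v ∈ nearest Q c)
    (hw : w ∈ nearest Q c) : val Q (toReal v - c) = val Q (toReal w - c) :=
  le_antisymm (hv w) (hw v)

lemma mem_nearest_of_le {c : Fin d → ℝ} {v w : Fin d → ℤ} (hv : v ∈ nearest Q c)
    (hw : val Q (toReal w - c) ≤ val Q (toReal v - c)) : w ∈ nearest Q c :=
  fun u => hw.trans (hv u)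

lemma bddBelow_range_val (hQ : Q.PosDef) (x : Fin d → ℝ) :
    BddBelow (Set.range fun v : Fin d → ℤ => val Q (x - toReal v)) :=
  ⟨0, by rintro _ ⟨v, rfl⟩; exact val_nonneg hQ _⟩

lemma iInf_val_eq (hQ : Q.PosDef) {c : Fin d → ℝ} {v : Fin d → ℤ} (hv : v ∈ nearest Q c) :
    ⨅ w : Fin d → ℤ, val Q (c - toReal w) = val Q (toReal v - c) := by
  refine le_antisymm ?_ (le_ciInf fun w => ?_)
  · rw [val_sub_comm]
    exact ciInf_le (bddBelow_range_val hQ c) v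
  · rw [val_sub_comm c]
    exact hv w

lemma exists_val_sub_le (Q : Matrix (Fin d) (Fin d) ℝ) :
    ∃ C : ℝ, ∀ x, ∃ v : Fin d → ℤ, val Q (x - toReal v) ≤ C := by
  refine ⟨(∑ i, ∑ j, |Q i j|) * d, fun x => ⟨fun i => ⌊x i⌋, ?_⟩⟩
  refine (le_abs_self _).trans ((abs_val_le _ _).trans ?_)
  refine mul_le_mul_of_nonneg_left ?_
    (Finset.sum_nonneg fun i _ => Finset.sum_nonneg fun j _ => abs_nonneg _)
  refine (Finset.sum_le_card_nsmul Finset.univ _ 1 fun i _ => ?_).trans (by simp)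
  simp only [Pi.sub_apply, toReal]
  have h1 := Int.fract_nonneg (x i)
  have h2 := Int.fract_lt_one (x i)
  rw [Int.self_sub_floor]
  nlinarith

lemma bddAbove_range_iInf_val (hQ : Q.PosDef) :
    BddAbove (Set.range fun x : Fin d → ℝ => ⨅ v : Fin d → ℤ, val Q (x - toReal v)) := by
  obtain ⟨C, hC⟩ := exists_val_sub_le Q
  refine ⟨C, ?_⟩
  rintro _ ⟨x, rfl⟩
  obtain ⟨v, hv⟩ := hC x
  exact (ciInf_le (bddBelow_range_val hQ x) v).trans hv

/-- Since the inner infimum is attained, a bound on μ is a covering statement. -/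
lemma inhomMin_le_iff (hQ : Q.PosDef) {t : ℝ} :
    inhomMin Q ≤ t ↔ ∀ x, ∃ v : Fin d → ℤ, val Q (x - toReal v) ≤ t := by
  constructor
  · intro h x
    obtain ⟨v, hv⟩ := nearest_nonempty hQ x
    refine ⟨v, le_trans ?_ h⟩
    rw [val_sub_comm, ← iInf_val_eq hQ hv]
    exact le_ciSup (bddAbove_range_iInf_val hQ) x
  · intro h
    refine ciSup_le fun x => ?_
    obtain ⟨v, hv⟩ := h x
    exact (ciInf_le (bddBelow_range_val hQ x) v).trans hv

lemma val_le_inhomMin (hQ : Q.PosDef) {c : Fin d → ℝ} {v : Fin d → ℤ} (hv : v ∈ nearest Q c) :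
    val Q (toReal v - c) ≤ inhomMin Q := by
  obtain ⟨w, hw⟩ := (inhomMin_le_iff hQ).1 le_rfl c
  rw [val_sub_comm] at hw
  exact (hv w).trans hw

lemma inhomMin_nonneg (hQ : Q.PosDef) : 0 ≤ inhomMin Q :=
  (val_nonneg hQ _).trans (val_le_inhomMin hQ (nearest_nonempty hQ 0).some_mem)

/-- The integral vectors that are not nearest to `c` stay away from `c` after a small affine
perturbation. -/
lemma eventually_nearest_perturb (hQ : Q.PosDef) (c y : Fin d → ℝ) (k : ℝ) :
    ∀ᶠ e in 𝓝[>] (0 : ℝ), ∀ v ∈ nearest Q c, ∀ w ∉ nearest Q c,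
      val Q (toReal v - c) + e * (y ⬝ᵥ toReal w + k) < val Q (toReal w - c) := by
  obtain ⟨v₀, hv₀⟩ := nearest_nonempty hQ c
  set m := val Q (toReal v₀ - c) with hm
  have hm0 : 0 ≤ m := val_nonneg hQ _
  obtain ⟨a, ha, hA⟩ := exists_mul_dotProduct_le_val hQ
  -- Only finitely many lattice vectors have value at most `m + 1`, so the values outside `nearest Q
  -- c` keep a gap from `m`.
  obtain ⟨δ, hδ, hgap⟩ : ∃ δ > 0, ∀ w ∉ nearest Q c, m + δ ≤ val Q (toReal w - c) := by
    let F : Set (Fin d → ℤ) := {w | val Q (toReal w - c) ≤ m + 1} \ nearest Q c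
    have hF : F.Finite := (finite_sublevel hQ c (m + 1)).sdiff
    rcases F.eq_empty_or_nonempty with h | h
    · refine ⟨1, one_pos, fun w hw => ?_⟩
      by_contra hc
      have : w ∈ F := ⟨(not_le.1 hc).le, hw⟩
      simp [h] at this
    · obtain ⟨u, hu, hmin⟩ := Set.exists_min_image F (fun v => val Q (toReal v - c)) hF h
      refine ⟨val Q (toReal u - c) - m, ?_, fun w hw => ?_⟩
      · rw [gt_iff_lt, sub_pos]
        by_contra hc
        exact hu.2 (mem_nearest_of_le hv₀ (not_lt.1 hc))
      · rw [add_sub_cancel]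
        by_cases hw' : val Q (toReal w - c) ≤ m + 1
        · exact hmin w ⟨hw', hw⟩
        · exact le_trans hu.1 (not_le.1 hw').le
  -- From 2 y·p ≤ p·p + y·y with p = w − c: the affine term grows no faster than the form.
  set K := 1 / (2 * a) + |(y ⬝ᵥ y) / 2 + y ⬝ᵥ c + k| with hK
  have hK0 : 0 < K := by positivity
  have hbound : ∀ w : Fin d → ℤ, y ⬝ᵥ toReal w + k ≤ K * (1 + val Q (toReal w - c)) := by
    intro w
    have h1 := dotProduct_self_nonneg' ((toReal w - c) - y)
    have h2 := hA (toReal w - c)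
    have h3 : (toReal w - c) ⬝ᵥ (toReal w - c) ≤ val Q (toReal w - c) / a := by
      rw [le_div_iff₀ ha]; linarith
    have h4 : y ⬝ᵥ toReal w = y ⬝ᵥ (toReal w - c) + y ⬝ᵥ c := by rw [dotProduct_sub]; ring
    rw [sub_dotProduct, dotProduct_sub _ (toReal w - c) y, dotProduct_sub y,
      dotProduct_comm (toReal w - c) y] at h1
    have h5 := le_abs_self ((y ⬝ᵥ y) / 2 + y ⬝ᵥ c + k)
    have h6 := val_nonneg hQ (toReal w - c)
    have h7 : (1 / (2 * a)) * val Q (toReal w - c) = (val Q (toReal w - c) / a) / 2 := by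
      field_simp
    have h8 : 0 ≤ 1 / (2 * a) := by positivity
    have h9 := mul_nonneg (abs_nonneg ((y ⬝ᵥ y) / 2 + y ⬝ᵥ c + k)) h6
    rw [hK, h4]
    nlinarith
  -- Once eK < 1, the quantity t − m − eK(1 + t) increases in t, so it suffices that it is positive
  -- at t = m + δ.
  have hlim : Tendsto (fun e : ℝ => e * (K * (m + δ + 1))) (𝓝[>] 0) (𝓝 0) := by
    have : Continuous fun e : ℝ => e * (K * (m + δ + 1)) := by fun_prop
    simpa using (this.tendsto 0).mono_left nhdsWithin_le_nhds
  have hlim' : Tendsto (fun e : ℝ => e * K) (𝓝[>] 0) (𝓝 0) := by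
    have : Continuous fun e : ℝ => e * K := by fun_prop
    simpa using (this.tendsto 0).mono_left nhdsWithin_le_nhds
  filter_upwards [hlim.eventually_lt_const hδ, hlim'.eventually_lt_const one_pos,
    self_mem_nhdsWithin] with e h1 h2 h3 v hv w hw
  rw [val_eq_of_mem_nearest hv hv₀, ← hm]
  have h4 := mul_le_mul_of_nonneg_left (hbound w) (le_of_lt (Set.mem_Ioi.1 h3))
  have h5 := hgap w hw
  nlinarith

lemma val_toReal_sub (hQ : Q.IsHermitian) (w : Fin d → ℤ) (c : Fin d → ℝ) :
    val Q (toReal w - c) = val Q (toReal w) - ((2 : ℝ) • Q *ᵥ c) ⬝ᵥ toReal w + val Q c := by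
  rw [val_sub hQ, smul_dotProduct, dotProduct_comm (Q *ᵥ c), smul_eq_mul]

lemma exists_mulVec_eq (hQ : Q.PosDef) (y : Fin d → ℝ) : ∃ u, Q *ᵥ u = y := by
  refine ⟨Q⁻¹ *ᵥ y, ?_⟩
  rw [mulVec_mulVec, mul_nonsing_inv _ ((isUnit_iff_isUnit_det _).1 hQ.isUnit), one_mulVec]

/-- An affine minorant of `Q` on the integral vectors which is attained exactly on `V` exhibits `V`
as a set of nearest vectors. -/
lemma exists_nearest_eq (hQ : Q.PosDef) {V : Set (Fin d → ℤ)} (hV : V.Nonempty) (y : Fin d → ℝ)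
    (k : ℝ) (h0 : ∀ w ∈ V, val Q (toReal w) = y ⬝ᵥ toReal w + k)
    (h1 : ∀ w ∉ V, y ⬝ᵥ toReal w + k < val Q (toReal w)) : ∃ c, nearest Q c = V := by
  -- Completing the square: with Qu = y/2, the form minus y·w equals Q[w − u] up to a constant.
  obtain ⟨u, hu⟩ := exists_mulVec_eq hQ ((1 / 2 : ℝ) • y)
  have e : ∀ w : Fin d → ℤ, val Q (toReal w - u) = val Q (toReal w) - y ⬝ᵥ toReal w + val Q u := by
    intro w
    rw [val_toReal_sub hQ.1, hu, smul_smul]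
    norm_num
  obtain ⟨v, hv⟩ := hV
  refine ⟨u, Set.ext fun w => ⟨fun hw => ?_, fun hw w' => ?_⟩⟩
  · by_contra hc
    have := hw v
    rw [e, e] at this
    linarith [h0 v hv, h1 w hc]
  · rw [e, e]
    by_cases hw' : w' ∈ V
    · linarith [h0 w hw, h0 w' hw']
    · linarith [h0 w hw, h1 w' hw']

lemma exists_weights_of_mem_convexHull {S : Set (Fin d → ℤ)} (hS : S.Finite) {x : Fin d → ℝ}
    (hx : x ∈ convexHull ℝ (toReal '' S)) :
    ∃ a : (Fin d → ℤ) → ℝ, (∀ v, 0 ≤ a v) ∧ ∑ v ∈ hS.toFinset, a v = 1 ∧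
      ∑ v ∈ hS.toFinset, a v • toReal v = x := by
  classical
  have h : toReal '' S = ((hS.toFinset.image toReal : Finset (Fin d → ℝ)) : Set (Fin d → ℝ)) := by
    simp
  rw [h, Finset.mem_convexHull'] at hx
  obtain ⟨w, h0, h1, h2⟩ := hx
  rw [Finset.sum_image toReal_injective.injOn] at h1 h2
  refine ⟨fun v => if v ∈ hS.toFinset then w (toReal v) else 0, fun v => ?_, ?_, ?_⟩
  · dsimp only
    split_ifs with hv
    · exact h0 _ (Finset.mem_image_of_mem _ hv)
    · exact le_rfl
  · rw [← h1]
    exact Finset.sum_congr rfl fun v hv => if_pos hv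
  · rw [← h2]
    exact Finset.sum_congr rfl fun v hv => by simp only [if_pos hv]

/-- Balls are convex: drop the nonnegative spread term in the parallel axis theorem. -/
lemma val_sub_le_of_mem_convexHull (hQ : Q.PosDef) {c x : Fin d → ℝ} {v : Fin d → ℤ}
    (hv : v ∈ nearest Q c) (hx : x ∈ convexHull ℝ (toReal '' nearest Q c)) :
    val Q (x - c) ≤ val Q (toReal v - c) := by
  obtain ⟨a, h0, h1, h2⟩ := exists_weights_of_mem_convexHull (nearest_finite hQ c) hx
  have h := sum_mul_val_sub hQ.1 _ a toReal h1 h2 c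
  have h3 : ∑ w ∈ (nearest_finite hQ c).toFinset, a w * val Q (toReal w - c)
      = val Q (toReal v - c) := by
    rw [← one_mul (val Q (toReal v - c)), ← h1, Finset.sum_mul]
    refine Finset.sum_congr rfl fun w hw => ?_
    rw [val_eq_of_mem_nearest (by simpa using hw) hv]
  have h4 : 0 ≤ ∑ w ∈ (nearest_finite hQ c).toFinset, a w * val Q (toReal w - x) :=
    Finset.sum_nonneg fun w _ => mul_nonneg (h0 w) (val_nonneg hQ _)
  linarith

/-- The hull lies in the closed ball around `c` whose lattice points are exactly `nearest Q c`.
Hence a Delone polytope determines its lattice vectors, and subdivisions can be compared through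
`nearest`. -/
lemma toReal_mem_convexHull_nearest (hQ : Q.PosDef) {c : Fin d → ℝ} {v : Fin d → ℤ} :
    toReal v ∈ convexHull ℝ (toReal '' nearest Q c) ↔ v ∈ nearest Q c := by
  refine ⟨fun h => ?_, fun h => subset_convexHull ℝ _ ⟨v, h, rfl⟩⟩
  obtain ⟨w, hw⟩ := nearest_nonempty hQ c
  exact mem_nearest_of_le hw (val_sub_le_of_mem_convexHull hQ hw h)

lemma convexHull_nearest_inj (hA : A.PosDef) (hB : B.PosDef) {a b : Fin d → ℝ}
    (h : convexHull ℝ (toReal '' nearest A a) = convexHull ℝ (toReal '' nearest B b)) :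
    nearest A a = nearest B b := by
  ext v
  rw [← toReal_mem_convexHull_nearest hA, h, toReal_mem_convexHull_nearest hB]

/-! ### Delone polytopes as hulls of nearest sets -/

lemma isDelonePolytope_iff (hQ : Q.PosDef) {L : Set (Fin d → ℝ)} :
    IsDelonePolytope Q L ↔ ∃ c, L = convexHull ℝ (toReal '' nearest Q c) := by
  constructor
  · rintro ⟨V, ⟨v, hv⟩, rfl, c, r, h1, h2⟩
    refine ⟨c, ?_⟩
    congr 2
    ext w
    refine ⟨fun hw u => ?_, fun hw => ?_⟩
    · rw [h1 w hw]
      by_cases hu : u ∈ V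
      · rw [h1 u hu]
      · exact (h2 u hu).le
    · by_contra hc
      have := h2 w hc
      have := hw v
      linarith [h1 v hv]
  · rintro ⟨c, rfl⟩
    obtain ⟨v, hv⟩ := nearest_nonempty hQ c
    refine ⟨(nearest_finite hQ c).toFinset, ⟨v, by simpa using hv⟩, by simp, c,
      Real.sqrt (val Q (toReal v - c)), fun w hw => ?_, fun w hw => ?_⟩
    · rw [Real.sq_sqrt (val_nonneg hQ _)]
      exact val_eq_of_mem_nearest (by simpa using hw) hv
    · rw [Real.sq_sqrt (val_nonneg hQ _)]
      by_contra hc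
      exact hw (by simpa using mem_nearest_of_le hv (not_lt.1 hc))

lemma del_subset_iff (hA : A.PosDef) (hB : B.PosDef) :
    Del A ⊆ Del B ↔ ∀ a, ∃ b, nearest A a = nearest B b := by
  constructor
  · intro h a
    obtain ⟨b, hb⟩ := (isDelonePolytope_iff hB).1 (h ((isDelonePolytope_iff hA).2 ⟨a, rfl⟩))
    exact ⟨b, convexHull_nearest_inj hA hB hb⟩
  · intro h L hL
    obtain ⟨a, rfl⟩ := (isDelonePolytope_iff hA).1 hL
    obtain ⟨b, hb⟩ := h a
    exact (isDelonePolytope_iff hB).2 ⟨b, by rw [hb]⟩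

/-! ### Extremal centres: covering of space and the largest circumradius -/

lemma continuous_val (Q : Matrix (Fin d) (Fin d) ℝ) : Continuous (val Q) := by
  unfold val; fun_prop

lemma upperSemicontinuous_iInf_val (hQ : Q.PosDef) :
    UpperSemicontinuous fun x : Fin d → ℝ => ⨅ v : Fin d → ℤ, val Q (x - toReal v) :=
  upperSemicontinuous_ciInf (bddBelow_range_val hQ) fun v =>
    ((continuous_val Q).comp (by fun_prop : Continuous fun x => x - toReal v)).upperSemicontinuous

/-- The distance to the lattice is periodic and upper semicontinuous, so a maximum over the unit
cube is global. -/
lemma exists_forall_iInf_val_le (hQ : Q.PosDef) :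
    ∃ c, ∀ c', ⨅ v : Fin d → ℤ, val Q (c' - toReal v) ≤ ⨅ v : Fin d → ℤ, val Q (c - toReal v) := by
  obtain ⟨c, -, hc⟩ := (upperSemicontinuous_iInf_val hQ).upperSemicontinuousOn
    (Set.Icc (0 : Fin d → ℝ) 1) |>.exists_isMaxOn ⟨0, by simp⟩ isCompact_Icc
  refine ⟨c, fun c' => ?_⟩
  have h : (fun i => Int.fract (c' i)) ∈ Set.Icc (0 : Fin d → ℝ) 1 :=
    ⟨fun i => Int.fract_nonneg _, fun i => (Int.fract_lt_one _).le⟩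
  refine le_trans (le_ciInf fun v => ?_) (hc h)
  have e : (fun i => Int.fract (c' i)) - toReal v = c' - toReal (v + fun i => ⌊c' i⌋) := by
    ext i
    simp only [Pi.sub_apply, toReal, Pi.add_apply, Int.cast_add, Int.fract]
    ring
  rw [e]
  exact ciInf_le (bddBelow_range_val hQ c') _

lemma isCompact_sublevel (hQ : Q.PosDef) (x : Fin d → ℝ) (t : ℝ) :
    IsCompact {c | val Q (x - c) ≤ t} := by
  obtain ⟨a, ha, h⟩ := exists_mul_dotProduct_le_val hQ
  have hc : Continuous fun c => val Q (x - c) := (continuous_val Q).comp (by fun_prop)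
  refine Metric.isCompact_of_isClosed_isBounded (isClosed_le hc continuous_const) ?_
  refine isBounded_iff_forall_norm_le.2 ⟨2 * (t / a) + 2 * (x ⬝ᵥ x) + 1, fun c hc => ?_⟩
  have h1 : (c - x) ⬝ᵥ (c - x) ≤ t / a := by
    rw [le_div_iff₀ ha, mul_comm]
    refine (h _).trans ?_
    rw [val_sub_comm]
    exact hc
  have h2 := dotProduct_self_le c x
  have h3 := dotProduct_self_nonneg' c
  refine (pi_norm_le_iff_of_nonneg (by linarith)).2 fun i => ?_
  have h4 : c i * c i ≤ c ⬝ᵥ c :=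
    Finset.single_le_sum (f := fun i => c i * c i) (fun i _ => mul_self_nonneg _)
      (Finset.mem_univ i)
  rw [Real.norm_eq_abs, abs_le]
  constructor <;> nlinarith

/-- The maximiser will be the centre of a Delone polytope containing `x`. The objective is
nonnegative at `c = x` and negative where Q[x − c] > μ(Q), so a compact ball suffices. -/
lemma exists_forall_iInf_val_sub_le (hQ : Q.PosDef) (x : Fin d → ℝ) :
    ∃ c, ∀ c', (⨅ v : Fin d → ℤ, val Q (c' - toReal v)) - val Q (x - c') ≤
      (⨅ v : Fin d → ℤ, val Q (c - toReal v)) - val Q (x - c) := by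
  have hcont : Continuous fun c => - val Q (x - c) :=
    ((continuous_val Q).comp (by fun_prop)).neg
  have hu := (upperSemicontinuous_iInf_val hQ).add hcont.upperSemicontinuous
  have hx : x ∈ {c | val Q (x - c) ≤ inhomMin Q} := by
    simpa [val_zero] using inhomMin_nonneg hQ
  obtain ⟨c, -, hc⟩ := (hu.upperSemicontinuousOn _).exists_isMaxOn ⟨x, hx⟩
    (isCompact_sublevel hQ x (inhomMin Q))
  refine ⟨c, fun c' => ?_⟩
  by_cases h : val Q (x - c') ≤ inhomMin Q
  · have := hc h
    simpa [sub_eq_add_neg] using this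
  · have h1 := hc hx
    simp only [Set.mem_ofPred_eq, sub_self, val_zero, neg_zero, add_zero] at h1
    have h2 : (⨅ v : Fin d → ℤ, val Q (c' - toReal v)) ≤ inhomMin Q :=
      le_ciSup (bddAbove_range_iInf_val hQ) c'
    have h3 : 0 ≤ ⨅ v : Fin d → ℤ, val Q (x - toReal v) := le_ciInf fun v => val_nonneg hQ _
    linarith

lemma val_sub_add_smul (hQ : Q.IsHermitian) (w c u : Fin d → ℝ) (e : ℝ) :
    val Q (w - (c + e • u)) = val Q (w - c) - 2 * e * ((Q *ᵥ u) ⬝ᵥ (w - c)) + e ^ 2 * val Q u := by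
  rw [← sub_sub, val_sub hQ, val_smul, mulVec_smul, dotProduct_smul, smul_eq_mul,
    dotProduct_comm (w - c)]
  ring

lemma exists_dotProduct_eq (f : (Fin d → ℝ) →ₗ[ℝ] ℝ) : ∃ y : Fin d → ℝ, ∀ z, f z = y ⬝ᵥ z := by
  refine ⟨fun i => f (Pi.single i 1), fun z => ?_⟩
  conv_lhs => rw [← Finset.univ_sum_single z]
  rw [map_sum]
  refine Finset.sum_congr rfl fun i _ => ?_
  have : (Pi.single i (z i) : Fin d → ℝ) = z i • Pi.single i 1 := by
    rw [← Pi.single_smul]; simp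
  rw [this, map_smul, smul_eq_mul, mul_comm]

/-- The Delone polytopes cover the whole space. -/
theorem exists_mem_convexHull_nearest (hQ : Q.PosDef) (x : Fin d → ℝ) :
    ∃ c, x ∈ convexHull ℝ (toReal '' nearest Q c) := by
  obtain ⟨c, hc⟩ := exists_forall_iInf_val_sub_le hQ x
  refine ⟨c, ?_⟩
  by_contra hx
  -- If `x` is separated from the hull by y, moving `c` to c + eu with Qu = y increases the
  -- maximised objective: the e² terms cancel, vectors of `nearest Q c` gain by separation, and the
  -- others are controlled by `eventually_nearest_perturb`.
  obtain ⟨f, s, hf, hs⟩ := geometric_hahn_banach_closed_point (convex_convexHull ℝ _)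
    (((nearest_finite hQ c).image toReal).isClosed_convexHull (𝕜 := ℝ)) hx
  obtain ⟨y, hy⟩ := exists_dotProduct_eq f.toLinearMap
  replace hy : ∀ z, f z = y ⬝ᵥ z := hy
  obtain ⟨u, hu⟩ := exists_mulVec_eq hQ y
  obtain ⟨v₀, hv₀⟩ := nearest_nonempty hQ c
  obtain ⟨e, he, he0⟩ := ((eventually_nearest_perturb hQ c ((2 : ℝ) • y) (-2 * (y ⬝ᵥ x))).and
    self_mem_nhdsWithin).exists
  replace he0 : 0 < e := he0
  obtain ⟨w, hw⟩ := nearest_nonempty hQ (c + e • u)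
  have h1 := hc (c + e • u)
  rw [iInf_val_eq hQ hw, iInf_val_eq hQ hv₀, val_sub_add_smul hQ.1, val_sub_add_smul hQ.1, hu,
    dotProduct_sub, dotProduct_sub] at h1
  by_cases hw' : w ∈ nearest Q c
  · have h2 := hf _ (subset_convexHull ℝ _ ⟨w, hw', rfl⟩)
    rw [hy] at h2 hs
    have h3 := val_eq_of_mem_nearest hw' hv₀
    nlinarith
  · have h2 := he v₀ hv₀ w hw'
    rw [smul_dotProduct, smul_eq_mul] at h2
    linarith

/-- The inhomogeneous minimum is the squared circumradius of a full-dimensional Delone polytope. -/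
theorem exists_affineSpan_nearest_eq_top (hQ : Q.PosDef) :
    ∃ c, affineSpan ℝ (toReal '' nearest Q c) = ⊤ ∧
      ∀ v ∈ nearest Q c, val Q (toReal v - c) = inhomMin Q := by
  obtain ⟨c, hc⟩ := exists_forall_iInf_val_le hQ
  obtain ⟨v₀, hv₀⟩ := nearest_nonempty hQ c
  refine ⟨c, ?_, fun v hv => ?_⟩
  swap
  · rw [← iInf_val_eq hQ hv]
    exact le_antisymm (le_ciSup (bddAbove_range_iInf_val hQ) c) (ciSup_le hc)
  -- Otherwise some nonzero functional is constant on the vertices. With the right sign, moving the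
  -- centre in its direction moves it away from all of them, contradicting maximality; the term
  -- e²Q[u] makes the gain strict.
  by_contra hne
  have hp : (toReal v₀) ∈ affineSpan ℝ (toReal '' nearest Q c) :=
    subset_affineSpan ℝ _ ⟨v₀, hv₀, rfl⟩
  have hdir : (affineSpan ℝ (toReal '' nearest Q c)).direction < ⊤ := by
    rw [lt_top_iff_ne_top]
    exact fun h => hne ((AffineSubspace.direction_eq_top_iff_of_nonempty ⟨_, hp⟩).1 h)
  obtain ⟨f, hf0, hf⟩ := Submodule.exists_le_ker_of_lt_top _ hdir
  obtain ⟨y, hy⟩ := exists_dotProduct_eq f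
  have hy0 : y ≠ 0 := by
    rintro rfl
    exact hf0 (LinearMap.ext fun z => by simp [hy])
  have hconst : ∀ v ∈ nearest Q c, y ⬝ᵥ toReal v = y ⬝ᵥ toReal v₀ := by
    intro v hv
    have : toReal v -ᵥ toReal v₀ ∈ (affineSpan ℝ (toReal '' nearest Q c)).direction :=
      AffineSubspace.vsub_mem_direction (subset_affineSpan ℝ _ ⟨v, hv, rfl⟩) hp
    have h := hf this
    rw [LinearMap.mem_ker, hy, vsub_eq_sub, dotProduct_sub, sub_eq_zero] at h
    exact h
  obtain ⟨y', hy'0, hconst', hsign⟩ : ∃ y' : Fin d → ℝ, y' ≠ 0 ∧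
      (∀ v ∈ nearest Q c, y' ⬝ᵥ toReal v = y' ⬝ᵥ toReal v₀) ∧ y' ⬝ᵥ toReal v₀ ≤ y' ⬝ᵥ c := by
    rcases le_total (y ⬝ᵥ toReal v₀) (y ⬝ᵥ c) with h | h
    · exact ⟨y, hy0, hconst, h⟩
    · exact ⟨-y, neg_ne_zero.2 hy0, fun v hv => by simp [neg_dotProduct, hconst v hv],
        by simpa [neg_dotProduct] using h⟩
  obtain ⟨u, hu⟩ := exists_mulVec_eq hQ y'
  have hu0 : u ≠ 0 := by
    rintro rfl
    exact hy'0 (by simpa using hu.symm)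
  obtain ⟨e, he, he0⟩ := ((eventually_nearest_perturb hQ c ((2 : ℝ) • y') (-2 * (y' ⬝ᵥ c))).and
    self_mem_nhdsWithin).exists
  replace he0 : 0 < e := he0
  obtain ⟨w, hw⟩ := nearest_nonempty hQ (c + e • u)
  have h1 := hc (c + e • u)
  have hpos : 0 < e ^ 2 * val Q u := mul_pos (by positivity) (val_pos hQ hu0)
  rw [iInf_val_eq hQ hw, iInf_val_eq hQ hv₀, val_sub_add_smul hQ.1, hu, dotProduct_sub] at h1
  by_cases hw' : w ∈ nearest Q c
  · have h3 := val_eq_of_mem_nearest hw' hv₀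
    rw [hconst' w hw'] at h1
    nlinarith
  · have h2 := he v₀ hv₀ w hw'
    rw [smul_dotProduct, smul_eq_mul] at h2
    nlinarith

/-! ### Continuity and quasiconvexity of μ -/

lemma inhomMin_smul {s : ℝ} (hs : 0 ≤ s) (Q : Matrix (Fin d) (Fin d) ℝ) :
    inhomMin (s • Q) = s * inhomMin Q := by
  simp only [inhomMin, val_form_smul]
  rw [Real.mul_iSup_of_nonneg hs]
  simp_rw [Real.mul_iInf_of_nonneg hs]

lemma inhomMin_le_mul_of_val_le (hA : A.PosDef) (hB : B.PosDef) {s : ℝ} (hs : 0 ≤ s)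
    (h : ∀ x, val A x ≤ s * val B x) : inhomMin A ≤ s * inhomMin B := by
  refine (inhomMin_le_iff hA).2 fun x => ?_
  obtain ⟨v, hv⟩ := (inhomMin_le_iff hB).1 le_rfl x
  exact ⟨v, (h _).trans (mul_le_mul_of_nonneg_left hv hs)⟩

theorem continuousWithinAt_inhomMin (hQ : Q.PosDef) :
    ContinuousWithinAt inhomMin (posForms d) Q := by
  rw [ContinuousWithinAt, Metric.tendsto_nhds]
  intro ε hε
  have h0 := inhomMin_nonneg hQ
  set δ := min (1 / 2) (ε / (4 * (inhomMin Q + 1))) with hδ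
  have hδ0 : 0 < δ := lt_min one_half_pos (by positivity)
  have hδ1 : δ ≤ 1 / 2 := min_le_left _ _
  have hδ2 : δ * inhomMin Q ≤ ε / 4 := by
    have : δ * (4 * (inhomMin Q + 1)) ≤ ε := (le_div_iff₀ (by positivity)).1 (min_le_right _ _)
    nlinarith
  filter_upwards [self_mem_nhdsWithin,
    nhdsWithin_le_nhds (eventually_abs_val_sub_le hQ hδ0)] with Q' hQ' h
  have h1 : inhomMin Q' ≤ (1 + δ) * inhomMin Q :=
    inhomMin_le_mul_of_val_le hQ' hQ (by linarith) fun x => by linarith [(abs_le.1 (h x)).2]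
  -- Uses (1 + 2δ)(1 − δ) ≥ 1, valid for 0 ≤ δ ≤ 1/2.
  have h2 : inhomMin Q ≤ (1 + 2 * δ) * inhomMin Q' :=
    inhomMin_le_mul_of_val_le hQ hQ' (by linarith) fun x => by
      have h3 := (abs_le.1 (h x)).1
      have h4 := val_nonneg hQ x
      have h5 : (1 - δ) * val Q x ≤ val Q' x := by linarith
      have h6 : (1 + 2 * δ) * ((1 - δ) * val Q x) ≤ (1 + 2 * δ) * val Q' x :=
        mul_le_mul_of_nonneg_left h5 (by linarith)
      have h7 : 0 ≤ δ * (1 - 2 * δ) * val Q x :=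
        mul_nonneg (mul_nonneg hδ0.le (by linarith)) h4
      nlinarith
  rw [Real.dist_eq, abs_lt]
  constructor <;> nlinarith

/-- On the forms with a fixed Delone subdivision, the inhomogeneous minimum is quasiconvex. -/
theorem inhomMin_add_le (hA : A.PosDef) (hB : B.PosDef) (hAB : Del A = Del B) {s t r : ℝ}
    (hs : 0 ≤ s) (ht : 0 ≤ t) (hst : s + t = 1) (hA1 : inhomMin A ≤ r) (hB1 : inhomMin B ≤ r)
    (hP : (s • A + t • B).PosDef) : inhomMin (s • A + t • B) ≤ r := by
  -- The weighted mean of C[v − x] over the vertices is the squared circumradius minus C[x − c],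
  -- hence at most μ(C). For fixed vertices and weights it is linear in C, so the bound passes to
  -- convex combinations; some vertex is then within `r` of `x`.
  have key : ∀ {C : Matrix (Fin d) (Fin d) ℝ} (hC : C.PosDef) (_ : inhomMin C ≤ r)
      {c x : Fin d → ℝ} {F : Finset (Fin d → ℤ)} {a : (Fin d → ℤ) → ℝ} (_ : (F : Set _) = nearest C c)
      (_ : ∑ v ∈ F, a v = 1) (_ : ∑ v ∈ F, a v • toReal v = x),
      ∑ v ∈ F, a v * val C (toReal v - x) ≤ r := by
    intro C hC hC1 c x F a hF h1 h2
    obtain ⟨v, hv⟩ := nearest_nonempty hC c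
    have h := sum_mul_val_sub hC.1 _ a toReal h1 h2 c
    have h3 : ∑ w ∈ F, a w * val C (toReal w - c) = val C (toReal v - c) := by
      rw [← one_mul (val C (toReal v - c)), ← h1, Finset.sum_mul]
      refine Finset.sum_congr rfl fun w hw => ?_
      rw [val_eq_of_mem_nearest (hF ▸ Finset.mem_coe.2 hw : w ∈ nearest C c) hv]
    linarith [val_le_inhomMin hC hv, val_nonneg hC (x - c)]
  refine (inhomMin_le_iff hP).2 fun x => ?_
  obtain ⟨c, hc⟩ := exists_mem_convexHull_nearest hA x
  obtain ⟨c', hc'⟩ := (del_subset_iff hA hB).1 hAB.subset c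
  obtain ⟨a, h0, h1, h2⟩ := exists_weights_of_mem_convexHull (nearest_finite hA c) hc
  have k1 := key hA hA1 (c := c) (by simp) h1 h2
  have k2 := key hB hB1 (c := c') (by simpa using hc') h1 h2
  by_contra hcon
  push Not at hcon
  have h3 : ∑ v ∈ (nearest_finite hA c).toFinset, a v * val (s • A + t • B) (toReal v - x) ≤ r := by
    simp_rw [val_form_add, val_form_smul, mul_add, Finset.sum_add_distrib, mul_left_comm _ s,
      mul_left_comm _ t, ← Finset.mul_sum]
    have := mul_le_mul_of_nonneg_left k1 hs
    have := mul_le_mul_of_nonneg_left k2 ht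
    have : s * r + t * r = r := by rw [← add_mul, hst, one_mul]
    linarith
  obtain ⟨v, hv, hav⟩ : ∃ v ∈ (nearest_finite hA c).toFinset, 0 < a v := by
    by_contra hne
    push Not at hne
    have := Finset.sum_nonpos hne
    linarith
  have h4 : ∑ v ∈ (nearest_finite hA c).toFinset, a v * r <
      ∑ v ∈ (nearest_finite hA c).toFinset, a v * val (s • A + t • B) (toReal v - x) :=
    Finset.sum_lt_sum
      (fun w _ => mul_le_mul_of_nonneg_left (by rw [val_sub_comm]; exact (hcon w).le) (h0 w))
      ⟨v, hv, mul_lt_mul_of_pos_left (by rw [val_sub_comm]; exact hcon v) hav⟩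
  rw [← Finset.sum_mul, h1, one_mul] at h4
  linarith

/-! ### Circumradii of simplices and the description of `W D` -/

lemma mem_extremePoints_of_affineIndependent {n : ℕ} {w : Fin n → Fin d → ℝ}
    (hw : AffineIndependent ℝ w) (i : Fin n) :
    w i ∈ (convexHull ℝ (Set.range w)).extremePoints ℝ := by
  classical
  have hrep : ∀ x ∈ convexHull ℝ (Set.range w), ∃ a : Fin n → ℝ, (∀ j, 0 ≤ a j) ∧ ∑ j, a j = 1 ∧
      ∑ j, a j • w j = x := by
    intro x hx
    have h : Set.range w = ((Finset.univ.image w : Finset (Fin d → ℝ)) : Set (Fin d → ℝ)) := by simp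
    rw [h, Finset.mem_convexHull'] at hx
    obtain ⟨a, h0, h1, h2⟩ := hx
    rw [Finset.sum_image hw.injective.injOn] at h1 h2
    exact ⟨fun j => a (w j), fun j => h0 _ (Finset.mem_image_of_mem _ (Finset.mem_univ j)), h1, h2⟩
  refine ⟨subset_convexHull ℝ _ ⟨i, rfl⟩, fun x hx y hy hxy => ?_⟩
  obtain ⟨a, ha0, ha1, hax⟩ := hrep x hx
  obtain ⟨b, hb0, hb1, hby⟩ := hrep y hy
  obtain ⟨s, t, hs, ht, hst, hz⟩ := hxy
  have key := (affineIndependent_iff.1 hw) Finset.univ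
    (fun j => s * a j + t * b j - Pi.single (M := fun _ => ℝ) i 1 j)
    (by simp [Finset.sum_add_distrib, ← Finset.mul_sum, ha1, hb1, hst])
    (by
      simp only [sub_smul, add_smul, mul_smul, Finset.sum_sub_distrib, Finset.sum_add_distrib,
        ← Finset.smul_sum, hax, hby, hz]
      simp [Pi.single_apply, ite_smul])
  have ha : ∀ j, j ≠ i → a j = 0 := by
    intro j hj
    have := key j (Finset.mem_univ j)
    simp only [Pi.single_eq_of_ne hj] at this
    have h1 := mul_nonneg hs.le (ha0 j)
    have h2 := mul_nonneg ht.le (hb0 j)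
    have h3 : s * a j = 0 := by linarith
    exact (mul_eq_zero.1 h3).resolve_left hs.ne'
  have hai : a i = 1 := by
    rw [← ha1, Finset.sum_eq_single i (fun j _ hj => ha j hj) (by simp)]
  rw [← hax, Finset.sum_eq_single i (fun j _ hj => by rw [ha j hj, zero_smul]) (by simp), hai,
    one_smul]

/-- Extreme points of a hull lie in its generating set, so any simplex presentation of a Delone
polytope uses only vectors of `nearest Q c`. -/
lemma exists_nearest_eq_vertex {n : ℕ} {w : Fin n → Fin d → ℝ}
    (hw : AffineIndependent ℝ w) {c : Fin d → ℝ}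
    (h : convexHull ℝ (toReal '' nearest Q c) = convexHull ℝ (Set.range w)) (i : Fin n) :
    ∃ v ∈ nearest Q c, toReal v = w i := by
  have hi := mem_extremePoints_of_affineIndependent hw i
  rw [← h] at hi
  exact (extremePoints_convexHull_subset hi : w i ∈ toReal '' nearest Q c)

/-- The sign of `det BR_L(Q)` decides whether the squared circumradius of `L` is at most `1`. -/
theorem det_BR_nonneg_iff (hQ : Q.PosDef) {w : Fin (d + 1) → Fin d → ℝ}
    (hw : AffineIndependent ℝ w) {c : Fin d → ℝ} {r : ℝ} (h : ∀ i, val Q (w i - c) = r) :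
    0 ≤ (BR (fun i => w i.succ - w 0) Q).det ↔ r ≤ 1 := by
  set v : Fin d → Fin d → ℝ := fun i => w i.succ - w 0 with hv
  set z : Fin d → ℝ := c - w 0 with hz
  let V : Matrix (Fin d) (Fin d) ℝ := Matrix.of v
  have hli : LinearIndependent ℝ v := by
    have h1 := (affineIndependent_iff_linearIndependent_vsub ℝ w 0).1 hw
    exact h1.comp (fun i : Fin d => (⟨i.succ, Fin.succ_ne_zero i⟩ : {x : Fin (d + 1) // x ≠ 0}))
      fun i j hij => Fin.succ_injective _ (congrArg Subtype.val hij)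
  have hVu : IsUnit V := Matrix.linearIndependent_rows_iff_isUnit.1 hli
  have hVd : V.det ≠ 0 := ((isUnit_iff_isUnit_det _).1 hVu).ne_zero
  let G : Matrix (Fin d) (Fin d) ℝ := Matrix.of fun i j => v i ⬝ᵥ Q *ᵥ v j
  have hG : G = V * Q * Vᵀ := by
    rw [Matrix.mul_assoc]
    ext i j
    simp only [G, V, Matrix.of_apply, Matrix.mul_apply, dotProduct, mulVec,
      transpose_apply]
  have hGd : 0 < G.det := by
    rw [hG, det_mul, det_mul, det_transpose]
    have := hQ.det_pos
    have : 0 < V.det ^ 2 * Q.det := by positivity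
    linarith
  -- With b the vector of squared lengths and z the circumcentre seen from `w 0`, equidistance says
  -- b = V Q (2z). So this y solves Gy = b, and b·y = 4Q[z] = 4r: the Schur complement of G in `BR`
  -- is 4 − 4r.
  obtain ⟨y, hy⟩ : ∃ y, Vᵀ *ᵥ y = (2 : ℝ) • z := by
    refine ⟨(Vᵀ)⁻¹ *ᵥ ((2 : ℝ) • z), ?_⟩
    rw [mulVec_mulVec, mul_nonsing_inv _ (by rw [det_transpose]; exact hVd.isUnit), one_mulVec]
  have hzr : val Q z = r := by rw [hz, val_sub_comm]; exact h 0
  have hb : ∀ i, v i ⬝ᵥ Q *ᵥ v i = v i ⬝ᵥ Q *ᵥ ((2 : ℝ) • z) := by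
    intro i
    have h1 := h i.succ
    have e : w i.succ - c = v i - z := by simp only [hv, hz]; abel
    rw [e, val_sub hQ.1, hzr] at h1
    rw [mulVec_smul, dotProduct_smul, smul_eq_mul]
    change val Q (v i) = _
    linarith
  have hGy : G *ᵥ y = fun i => v i ⬝ᵥ Q *ᵥ v i := by
    rw [hG, ← mulVec_mulVec, ← mulVec_mulVec, hy]
    ext i
    rw [hb]
    rfl
  have hby : (fun i => v i ⬝ᵥ Q *ᵥ v i) ⬝ᵥ y = 4 * r := by
    have : (fun i => v i ⬝ᵥ Q *ᵥ v i) = V *ᵥ (Q *ᵥ ((2 : ℝ) • z)) := by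
      ext i
      rw [hb]
      rfl
    rw [this, dotProduct_comm, dotProduct_mulVec, ← mulVec_transpose, hy, ← hzr, val,
      mulVec_smul, dotProduct_smul, smul_dotProduct, smul_eq_mul, smul_eq_mul]
    ring
  let _ : Invertible G := invertibleOfIsUnitDet G hGd.ne'.isUnit
  have hdet : (BR v Q).det = G.det * (4 - 4 * r) := by
    have e1 : (Matrix.of fun i (_ : Unit) => v i ⬝ᵥ Q *ᵥ v i : Matrix (Fin d) Unit ℝ)
        = G * Matrix.of fun i _ => y i := by
      ext i j
      exact (congrFun hGy i).symm
    rw [BR, det_fromBlocks₂₂ (D := G), e1, Matrix.mul_assoc, Matrix.invOf_mul_cancel_left,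
      det_unique (n := Unit)]
    congr 1
    have : (Matrix.of (fun (_ : Unit) j => v j ⬝ᵥ Q *ᵥ v j) *
      Matrix.of fun i (_ : Unit) => y i) default default = 4 * r := hby
    rw [Matrix.sub_apply, this, of_apply]
  rw [hdet, mul_nonneg_iff_of_pos_left hGd]
  constructor <;> intro <;> linarith

/-- Within the secondary cone of a triangulation, `W_D` consists of the forms with `μ ≤ 1`. -/
theorem mem_W_iff {D : Set (Set (Fin d → ℝ))} (hD : IsDeloneTriangulation D)
    (hQ : Q ∈ secondaryCone D) : Q ∈ W D ↔ inhomMin Q ≤ 1 := by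
  obtain ⟨hP, hDel⟩ := hQ
  replace hP : Q.PosDef := hP
  constructor
  · rintro ⟨h, -⟩
    -- One full-dimensional polytope realises μ, and its determinant condition alone gives the
    -- bound; spanning forces its simplex to have d + 1 vertices.
    obtain ⟨c, hspan, hc⟩ := exists_affineSpan_nearest_eq_top hP
    have hL : convexHull ℝ (toReal '' nearest Q c) ∈ D :=
      hDel ▸ (isDelonePolytope_iff hP).2 ⟨c, rfl⟩
    obtain ⟨n, w, hw, hLw⟩ := hD.2 _ hL
    have hspan' : affineSpan ℝ (Set.range w) = ⊤ := by
      rw [← affineSpan_convexHull, ← hLw, affineSpan_convexHull, hspan]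
    have hn := hw.affineSpan_eq_top_iff_card_eq_finrank_add_one.1 hspan'
    simp only [Fintype.card_fin, Module.finrank_fintype_fun_eq_card, add_left_inj] at hn
    subst hn
    refine (det_BR_nonneg_iff hP hw (c := c) fun i => ?_).1
      ((Set.mem_iInter₂.1 h _ hL).2 w hw hLw)
    obtain ⟨v, hv, hvw⟩ := exists_nearest_eq_vertex hw hLw i
    rw [← hvw, hc v hv]
  · intro h
    refine ⟨Set.mem_iInter₂.2 fun L hL => ⟨hP, fun w hw hLw => ?_⟩, hP, hDel⟩
    rw [← hDel] at hL
    obtain ⟨c, rfl⟩ := (isDelonePolytope_iff hP).1 hL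
    obtain ⟨u, hu⟩ := nearest_nonempty hP c
    refine (det_BR_nonneg_iff hP hw (c := c) (r := val Q (toReal u - c)) fun i => ?_).2
      ((val_le_inhomMin hP hu).trans h)
    obtain ⟨v, hv, hvw⟩ := exists_nearest_eq_vertex hw hLw i
    rw [← hvw, val_eq_of_mem_nearest hv hu]

/-! ### Refinement of Delone subdivisions -/

/-- A face of a Delone polytope of `A` is a Delone polytope of `A`; so a Delone subdivision
contained in another one is equal to it. -/
theorem del_eq_of_subset (hA : A.PosDef) (hB : B.PosDef) (h : Del A ⊆ Del B) : Del A = Del B := by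
  refine h.antisymm ((del_subset_iff hB hA).2 fun b => ?_)
  have h' := (del_subset_iff hA hB).1 h
  have hfin := nearest_finite hB b
  obtain ⟨u, hu⟩ := nearest_nonempty hB b
  set F := hfin.toFinset with hF
  have hmemF : ∀ v, v ∈ F ↔ v ∈ nearest B b := by simp [hF]
  have hcard : (0 : ℝ) < F.card := by
    exact_mod_cast Finset.card_pos.2 ⟨u, (hmemF u).2 hu⟩
  -- All weights are positive, so an upper bound on the weighted mean that equals the minimum forces
  -- every vertex to attain it.
  set α : (Fin d → ℤ) → ℝ := fun _ => (F.card : ℝ)⁻¹ with hα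
  have hα1 : ∑ v ∈ F, α v = 1 := by
    simp only [hα, Finset.sum_const, nsmul_eq_mul]
    exact mul_inv_cancel₀ hcard.ne'
  set x := ∑ v ∈ F, α v • toReal v with hx
  obtain ⟨a, hxa⟩ := exists_mem_convexHull_nearest hA x
  obtain ⟨b', hb'⟩ := h' a
  obtain ⟨u', hu'⟩ := nearest_nonempty hA a
  have hu'' : u' ∈ nearest B b' := hb' ▸ hu'
  obtain ⟨β, hβ0, hβ1, hβx⟩ := exists_weights_of_mem_convexHull (nearest_finite hA a) hxa
  set F' := (nearest_finite hA a).toFinset with hF'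
  have hmemF' : ∀ v, v ∈ F' ↔ v ∈ nearest B b' := by simp [hF', hb']
  set m := val B (toReal u - b)
  set m' := val B (toReal u' - b')
  have e1 : ∑ v ∈ F, α v * val B (toReal v - b) = m := by
    rw [← one_mul m, ← hα1, Finset.sum_mul]
    exact Finset.sum_congr rfl fun w hw => by rw [val_eq_of_mem_nearest ((hmemF w).1 hw) hu]
  have e2 : ∑ v ∈ F', β v * val B (toReal v - b') = m' := by
    rw [← one_mul m', ← hβ1, Finset.sum_mul]
    exact Finset.sum_congr rfl fun w hw => by rw [val_eq_of_mem_nearest ((hmemF' w).1 hw) hu'']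
  have e3 : m ≤ ∑ v ∈ F', β v * val B (toReal v - b) := by
    rw [← one_mul m, ← hβ1, Finset.sum_mul]
    exact Finset.sum_le_sum fun w _ => mul_le_mul_of_nonneg_left (hu w) (hβ0 w)
  have s1 := sum_mul_val_sub hB.1 F α toReal hα1 hx.symm b
  have s2 := sum_mul_val_sub hB.1 F α toReal hα1 hx.symm b'
  have s3 := sum_mul_val_sub hB.1 F' β toReal hβ1 hβx b
  have s4 := sum_mul_val_sub hB.1 F' β toReal hβ1 hβx b'
  -- By minimality at `b`, the spread of F about x is at most that of F'; transferring this to the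
  -- centre `b'` gives the bound.
  have hle : ∑ v ∈ F, α v * val B (toReal v - b') ≤ m' := by linarith
  have hsub : ∀ v ∈ nearest B b, v ∈ nearest B b' := by
    intro v hv
    refine mem_nearest_of_le hu'' ?_
    by_contra hc
    have hlt : ∑ v ∈ F, α v * m' < ∑ v ∈ F, α v * val B (toReal v - b') :=
      Finset.sum_lt_sum (fun w _ => mul_le_mul_of_nonneg_left (hu'' w) (inv_nonneg.2 hcard.le))
        ⟨v, (hmemF v).2 hv, mul_lt_mul_of_pos_left (not_le.1 hc) (inv_pos.2 hcard)⟩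
    rw [← Finset.sum_mul, hα1, one_mul] at hlt
    linarith
  -- On ℤ^d, y·p + k is the difference of the powers of p for the two spheres: zero on `nearest B
  -- b`, positive on the rest of `nearest B b'`. Subtracting a small multiple of it from the affine
  -- function touching A at `a` leaves contact only on `nearest B b`.
  set y : Fin d → ℝ := (2 : ℝ) • B *ᵥ b' - (2 : ℝ) • B *ᵥ b with hy
  set k : ℝ := val B b - val B b' - m + m' with hk
  have haff : ∀ p : Fin d → ℤ,
      y ⬝ᵥ toReal p + k = (val B (toReal p - b) - m) - (val B (toReal p - b') - m') := by
    intro p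
    rw [val_toReal_sub hB.1, val_toReal_sub hB.1, hy, sub_dotProduct, hk]
    ring
  obtain ⟨e, he, he0⟩ := ((eventually_nearest_perturb hA a (-y) (-k)).and
    self_mem_nhdsWithin).exists
  replace he0 : 0 < e := he0
  have hval : ∀ p : Fin d → ℤ, val A (toReal p) =
      val A (toReal p - a) + ((2 : ℝ) • A *ᵥ a) ⬝ᵥ toReal p - val A a := fun p => by
    rw [val_toReal_sub hA.1]; ring
  obtain ⟨c, hc⟩ := exists_nearest_eq hA ⟨u, hu⟩ ((2 : ℝ) • A *ᵥ a - e • y)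
    (val A (toReal u' - a) - val A a - e * k) (fun w hw => by
      have h1 := haff w
      have h2 : val A (toReal w - a) = val A (toReal u' - a) :=
        val_eq_of_mem_nearest (hb' ▸ hsub w hw) hu'
      rw [val_eq_of_mem_nearest hw hu, val_eq_of_mem_nearest (hsub w hw) hu''] at h1
      rw [hval, sub_dotProduct, smul_dotProduct e, smul_eq_mul, h2]
      linear_combination e * h1) (fun w hw => by
      rw [hval, sub_dotProduct, smul_dotProduct e, smul_eq_mul]
      by_cases hw' : w ∈ nearest B b'
      · have h1 := haff w
        rw [val_eq_of_mem_nearest hw' hu''] at h1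
        have h2 : val A (toReal w - a) = val A (toReal u' - a) :=
          val_eq_of_mem_nearest (hb' ▸ hw') hu'
        have h3 : 0 < y ⬝ᵥ toReal w + k := by
          have : m < val B (toReal w - b) := by
            by_contra hcon
            exact hw (mem_nearest_of_le hu (not_lt.1 hcon))
          linarith
        have := mul_pos he0 h3
        linarith
      · have h1 := he u' hu' w (hb' ▸ hw')
        rw [neg_dotProduct] at h1
        linarith)
  exact ⟨c, hc.symm⟩

lemma mem_nearest_add_toReal {c : Fin d → ℝ} {z v : Fin d → ℤ} :
    v ∈ nearest Q (c + toReal z) ↔ v - z ∈ nearest Q c := by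
  have e : ∀ w : Fin d → ℤ, toReal w - (c + toReal z) = toReal (w - z) - c := fun w => by
    ext i
    simp only [toReal, Pi.sub_apply, Pi.add_apply, Int.cast_sub]
    ring
  constructor
  · intro h w
    have := h (w + z)
    rwa [e, e, add_sub_cancel_right] at this
  · intro h w
    rw [e, e]
    exact h _

/-- The condition is closed in the pair (P, c), and projecting along the compact cube preserves
closedness. -/
lemma isClosed_setOf_exists_nearest (V : Set (Fin d → ℤ)) :
    IsClosed {P : Matrix (Fin d) (Fin d) ℝ | ∃ c ∈ Set.Icc (0 : Fin d → ℝ) 1, V ⊆ nearest P c} := by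
  have hcl : IsClosed {q : Matrix (Fin d) (Fin d) ℝ × Set.Icc (0 : Fin d → ℝ) 1 |
      V ⊆ nearest q.1 q.2} := by
    have : {q : Matrix (Fin d) (Fin d) ℝ × Set.Icc (0 : Fin d → ℝ) 1 | V ⊆ nearest q.1 q.2} =
        ⋂ v ∈ V, ⋂ w, {q | val q.1 (toReal v - q.2.1) ≤ val q.1 (toReal w - q.2.1)} := by
      ext q
      simp [Set.subset_def, nearest]
    rw [this]
    refine isClosed_biInter fun v _ => isClosed_iInter fun w => isClosed_le ?_ ?_ <;>
    · unfold val; fun_prop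
  have := isClosedMap_fst_of_compactSpace _ hcl
  convert this using 1
  ext P
  constructor
  · rintro ⟨c, hc, h⟩
    exact ⟨(P, ⟨c, hc⟩), h, rfl⟩
  · rintro ⟨⟨P', c⟩, h, rfl⟩
    exact ⟨c, c.2, h⟩

/-- The Delone subdivisions of the forms near `Q` refine the one of `Q`. -/
theorem eventually_nearest_subset (hQ : Q.PosDef) :
    ∀ᶠ P in 𝓝[posForms d] Q, ∀ c', ∃ c, nearest P c' ⊆ nearest Q c := by
  obtain ⟨a, ha, hA⟩ := exists_mul_dotProduct_le_val hQ
  set S := ∑ i, ∑ j, |Q i j|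
  have hS : 0 ≤ S := Finset.sum_nonneg fun i _ => Finset.sum_nonneg fun j _ => abs_nonneg _
  -- For centres in the unit cube and Q/2 ≤ P ≤ 3Q/2, nearest vectors satisfy Q[v − c] ≤ 3Q[c] ≤
  -- 3Sd. Thus only finitely many vertex sets occur, and the failure of each to fit `Q` is an open
  -- condition.
  have hfin := (finite_setOf_dotProduct_le (d := d) (2 * (3 * (S * d) / a) + 2 * d)).finite_subsets
  have hev : ∀ᶠ P in 𝓝 Q, ∀ V ∈ {V : Set (Fin d → ℤ) |
      V ⊆ {v | toReal v ⬝ᵥ toReal v ≤ 2 * (3 * (S * d) / a) + 2 * d}},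
      (∃ c ∈ Set.Icc (0 : Fin d → ℝ) 1, V ⊆ nearest P c) →
        ∃ c ∈ Set.Icc (0 : Fin d → ℝ) 1, V ⊆ nearest Q c := by
    refine (eventually_all_finite hfin).2 fun V _ => ?_
    by_cases hV : ∃ c ∈ Set.Icc (0 : Fin d → ℝ) 1, V ⊆ nearest Q c
    · exact Eventually.of_forall fun _ _ => hV
    · filter_upwards [(isClosed_setOf_exists_nearest V).isOpen_compl.mem_nhds hV] with P hP h
      exact absurd h hP
  filter_upwards [nhdsWithin_le_nhds hev, self_mem_nhdsWithin,
    nhdsWithin_le_nhds (eventually_abs_val_sub_le hQ one_half_pos)] with P h hP hPQ c'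
  set z : Fin d → ℤ := fun i => ⌊c' i⌋
  set c₀ : Fin d → ℝ := fun i => Int.fract (c' i) with hc₀
  have hcc : c' = c₀ + toReal z := by
    ext i
    exact (Int.fract_add_floor (c' i)).symm
  have hbox : c₀ ∈ Set.Icc (0 : Fin d → ℝ) 1 :=
    ⟨fun i => Int.fract_nonneg _, fun i => (Int.fract_lt_one _).le⟩
  have hc0 : c₀ ⬝ᵥ c₀ ≤ d := by
    refine (Finset.sum_le_card_nsmul Finset.univ _ 1 fun i _ => ?_).trans (by simp)
    have h1 : 0 ≤ c₀ i := hbox.1 i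
    have h2 : c₀ i ≤ 1 := hbox.2 i
    nlinarith
  obtain ⟨c, -, hc⟩ := h (nearest P c₀) (fun v hv => by
    refine (dotProduct_self_le (toReal v) c₀).trans ?_
    have h0 : toReal (0 : Fin d → ℤ) - c₀ = -c₀ := by ext i; simp [toReal]
    have h1 := hv 0
    have h2 := (abs_le.1 (hPQ (toReal v - c₀))).1
    have h3 := (abs_le.1 (hPQ (toReal 0 - c₀))).2
    simp only [h0, val_neg] at h1 h3
    have h4 : val Q c₀ ≤ S * d := (le_abs_self _).trans
      ((abs_val_le Q c₀).trans (mul_le_mul_of_nonneg_left hc0 hS))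
    have h5 : (toReal v - c₀) ⬝ᵥ (toReal v - c₀) ≤ 3 * (S * d) / a := by
      rw [le_div_iff₀ ha]
      linarith [hA (toReal v - c₀)]
    linarith) ⟨c₀, hbox, subset_rfl⟩
  refine ⟨c + toReal z, fun v hv => ?_⟩
  rw [hcc, mem_nearest_add_toReal] at hv
  exact mem_nearest_add_toReal.2 (hc hv)

/-- If the Delone subdivision of `A` refines that of `Q`, it is constant along the segment from `A`
to `Q`, apart from the end point `Q`. -/
theorem del_segment_eq (hQ : Q.PosDef) (hA : A.PosDef)
    (h : ∀ a, ∃ c, nearest A a ⊆ nearest Q c) {s : ℝ} (hs : 0 < s) (hs1 : s ≤ 1)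
    (hP : ((1 - s) • Q + s • A).PosDef) : Del ((1 - s) • Q + s • A) = Del A := by
  -- The convex combination of the affine functions touching Q at `c` and A at `a` touches the
  -- combined form exactly on `nearest A a`, since the weight of A is positive.
  refine (del_eq_of_subset hA hP ((del_subset_iff hA hP).2 fun a => ?_)).symm
  obtain ⟨c, hc⟩ := h a
  obtain ⟨u, hu⟩ := nearest_nonempty hA a
  have hval : ∀ {C : Matrix (Fin d) (Fin d) ℝ} (_ : C.PosDef) (p : Fin d → ℤ) (c : Fin d → ℝ),
      val C (toReal p) = val C (toReal p - c) + ((2 : ℝ) • C *ᵥ c) ⬝ᵥ toReal p - val C c :=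
    fun hC p c => by rw [val_toReal_sub hC.1]; ring
  obtain ⟨b, hb⟩ := exists_nearest_eq hP ⟨u, hu⟩
    ((1 - s) • ((2 : ℝ) • Q *ᵥ c) + s • ((2 : ℝ) • A *ᵥ a))
    ((1 - s) * (val Q (toReal u - c) - val Q c) + s * (val A (toReal u - a) - val A a))
    (fun w hw => by
      rw [val_form_add, val_form_smul, val_form_smul, hval hQ w c, hval hA w a,
        val_eq_of_mem_nearest hw hu, val_eq_of_mem_nearest (hc hw) (hc hu), add_dotProduct,
        smul_dotProduct (1 - s), smul_dotProduct s, smul_eq_mul, smul_eq_mul]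
      ring) (fun w hw => by
      rw [val_form_add, val_form_smul, val_form_smul, hval hQ w c, hval hA w a, add_dotProduct,
        smul_dotProduct (1 - s), smul_dotProduct s, smul_eq_mul, smul_eq_mul]
      have h1 : val A (toReal u - a) < val A (toReal w - a) := by
        by_contra hcon
        exact hw (mem_nearest_of_le hu (not_lt.1 hcon))
      have h2 := mul_lt_mul_of_pos_left h1 hs
      have h3 := mul_le_mul_of_nonneg_left (hc hu w) (sub_nonneg.2 hs1)
      linarith)
  exact ⟨b, hb.symm⟩

lemma tendsto_segment (Q A : Matrix (Fin d) (Fin d) ℝ) :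
    Tendsto (fun s : ℝ => (1 - s) • Q + s • A) (𝓝[>] 0) (𝓝 Q) := by
  have : Continuous fun s : ℝ => (1 - s) • Q + s • A := by fun_prop
  simpa using (this.tendsto 0).mono_left nhdsWithin_le_nhds

lemma eventually_posDef_segment (hQ : Q.PosDef) (hA : A.IsHermitian) :
    ∀ᶠ s in 𝓝[>] (0 : ℝ), ((1 - s) • Q + s • A).PosDef := by
  filter_upwards [(tendsto_segment Q A).eventually (eventually_posDef hQ)] with s hs
  exact hs ((hQ.1.smul (IsSelfAdjoint.all _)).add (hA.smul (IsSelfAdjoint.all _)))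

lemma mem_closure_secondaryCone (hQ : Q.PosDef) (hA : A.PosDef)
    (h : ∀ a, ∃ c, nearest A a ⊆ nearest Q c) : Q ∈ closure (secondaryCone (Del A)) := by
  refine mem_closure_of_tendsto (tendsto_segment Q A) ?_
  filter_upwards [eventually_posDef_segment hQ hA.1, Ioc_mem_nhdsGT one_pos] with s hP hs
  exact ⟨hP, del_segment_eq hQ hA h hs.1 hs.2 hP⟩

/-! ### Density of Delone triangulations -/

/-- `β` is an affine dependency of the vectors in `F`, possibly trivial. -/
def IsAffineDependency (F : Finset (Fin d → ℤ)) (β : (Fin d → ℤ) → ℝ) : Prop :=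
  ∑ v ∈ F, β v = 0 ∧ ∑ v ∈ F, β v • toReal v = 0

/-- If there is a nontrivial affine dependency on `F`, then some affine dependency on `F` is not
respected by all quadratic forms. -/
lemma exists_dependency_val_ne_zero {F : Finset (Fin d → ℤ)} {β : (Fin d → ℤ) → ℝ}
    (hβ : IsAffineDependency F β) (hne : ∃ v ∈ F, β v ≠ 0) :
    ∃ β', IsAffineDependency F β' ∧
      ∃ M : Matrix (Fin d) (Fin d) ℝ, ∑ v ∈ F, β' v * val M (toReal v) ≠ 0 := by
  classical
  by_contra hcon
  push Not at hcon
  induction hn : (F.filter fun v => β v ≠ 0).card using Nat.strong_induction_on generalizing β with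
  | _ n ih =>
  obtain ⟨v₀, hv₀, h0⟩ := hne
  -- Coefficients summing to zero cannot have a one-point support.
  obtain ⟨v₁, hv₁, h1, hv01⟩ : ∃ v₁ ∈ F, β v₁ ≠ 0 ∧ v₁ ≠ v₀ := by
    by_contra hc
    push Not at hc
    have := hβ.1
    rw [Finset.sum_eq_single v₀ (fun v hv hv' => by
      by_contra h
      exact hv' (hc v hv h)) (fun h => absurd hv₀ h)] at this
    exact h0 this
  obtain ⟨i, hi⟩ : ∃ i, v₁ i ≠ v₀ i := Function.ne_iff.1 hv01
  have hcoord : ∀ j, ∑ v ∈ F, β v * (v j : ℝ) = 0 := fun j => by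
    have := congrFun hβ.2 j
    simpa [Finset.sum_apply, toReal] using this
  have hquad : ∀ j, ∑ v ∈ F, β v * ((v i : ℝ) * v j) = 0 := fun j => by
    have := hcon β hβ (Matrix.single i j 1)
    simpa [val, toReal, Matrix.single_mulVec, dotProduct, Function.update_apply, mul_comm] using this
  -- If all quadratic forms respect β, multiplying it by the affine function v_i − (v₀)_i gives
  -- another dependency; it loses v₀ from the support and keeps v₁.
  refine ih (F.filter fun v => ((v i : ℝ) - v₀ i) * β v ≠ 0).card ?_
    (β := fun v => ((v i : ℝ) - v₀ i) * β v) ⟨?_, ?_⟩ ⟨v₁, hv₁, ?_⟩ rfl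
  · rw [← hn]
    refine Finset.card_lt_card (Finset.ssubset_iff_of_subset (fun v hv => ?_) |>.2 ⟨v₀, ?_, ?_⟩)
    · rw [Finset.mem_filter] at hv ⊢
      exact ⟨hv.1, right_ne_zero_of_mul hv.2⟩
    · simp [hv₀, h0]
    · simp
  · have : ∀ v ∈ F, ((v i : ℝ) - v₀ i) * β v = β v * v i - v₀ i * β v := fun v _ => by ring
    rw [Finset.sum_congr rfl this, Finset.sum_sub_distrib, hcoord, ← Finset.mul_sum, hβ.1]
    simp
  · ext j
    have : ∀ v ∈ F, ((v i : ℝ) - v₀ i) * β v * v j = β v * ((v i : ℝ) * v j) - v₀ i * (β v * v j) :=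
      fun v _ => by ring
    simp only [Finset.sum_apply, Pi.smul_apply, smul_eq_mul, toReal, Pi.zero_apply]
    rw [Finset.sum_congr rfl this, Finset.sum_sub_distrib, hquad, ← Finset.mul_sum, hcoord]
    simp
  · exact mul_ne_zero (sub_ne_zero.2 (by exact_mod_cast hi)) h1

lemma exists_dependency_of_not_isSimplex {F : Finset (Fin d → ℤ)} (hF : F.Nonempty)
    (h : ¬ IsSimplex (convexHull ℝ (toReal '' (F : Set (Fin d → ℤ))))) :
    ∃ G ⊆ F, ∃ β, IsAffineDependency G β ∧ ∃ v ∈ G, β v ≠ 0 := by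
  classical
  have hdep : ¬ AffineIndependent ℝ fun v : F => toReal v.1 := by
    intro hi
    refine h ⟨F.card - 1, fun j => toReal (F.equivFin.symm (Fin.cast
      (Nat.succ_pred_eq_of_pos (Finset.card_pos.2 hF)) j)).1, ?_, ?_⟩
    · exact hi.comp_embedding ⟨fun j => F.equivFin.symm (Fin.cast
        (Nat.succ_pred_eq_of_pos (Finset.card_pos.2 hF)) j),
        F.equivFin.symm.injective.comp (Fin.cast_injective _)⟩
    · congr 1
      ext x
      constructor
      · rintro ⟨v, hv, rfl⟩
        exact ⟨Fin.cast (Nat.succ_pred_eq_of_pos (Finset.card_pos.2 hF)).symm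
          (F.equivFin ⟨v, hv⟩), by simp⟩
      · rintro ⟨j, rfl⟩
        exact ⟨_, Subtype.prop _, rfl⟩
  rw [affineIndependent_iff] at hdep
  push Not at hdep
  obtain ⟨s, w, h1, h2, e, he, hne⟩ := hdep
  have hext : ∀ u : F, (if h : u.1 ∈ F then w ⟨u.1, h⟩ else 0) = w u := fun u => by simp
  refine ⟨s.map (Function.Embedding.subtype _), fun v hv => ?_,
    fun v => if h : v ∈ F then w ⟨v, h⟩ else 0, ⟨?_, ?_⟩, e.1, by simpa using he, ?_⟩
  · obtain ⟨u, -, rfl⟩ := Finset.mem_map.1 hv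
    exact u.2
  · rw [Finset.sum_map]
    exact (Finset.sum_congr rfl fun u _ => hext u).trans h1
  · rw [Finset.sum_map]
    exact (Finset.sum_congr rfl fun u _ => congrArg (· • toReal u.1) (hext u)).trans h2
  · exact (hext e).trans_ne hne

lemma val_transpose (M : Matrix (Fin d) (Fin d) ℝ) (x : Fin d → ℝ) : val Mᵀ x = val M x := by
  rw [val, val, mulVec_transpose, dotProduct_comm, ← dotProduct_mulVec]

/-- On `nearest Q c` the form is an affine function of the vector, and affine dependencies
annihilate those. -/
lemma sum_mul_val_eq_zero (hQ : Q.PosDef) {c : Fin d → ℝ} {F : Finset (Fin d → ℤ)}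
    (hF : ∀ v ∈ F, v ∈ nearest Q c) {β : (Fin d → ℤ) → ℝ} (hβ : IsAffineDependency F β) :
    ∑ v ∈ F, β v * val Q (toReal v) = 0 := by
  obtain ⟨u, hu⟩ := nearest_nonempty hQ c
  have h : ∀ v ∈ F, β v * val Q (toReal v) = β v * (val Q (toReal u - c) - val Q c)
      + ((2 : ℝ) • Q *ᵥ c) ⬝ᵥ (β v • toReal v) := fun v hv => by
    have h1 := val_toReal_sub hQ.1 v c
    rw [val_eq_of_mem_nearest (hF v hv) hu] at h1
    rw [dotProduct_smul, smul_eq_mul]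
    linear_combination (-β v) * h1
  rw [Finset.sum_congr rfl h, Finset.sum_add_distrib, ← Finset.sum_mul, ← dotProduct_sum, hβ.1,
    hβ.2]
  simp

/-- The forms whose Delone subdivision is a triangulation are dense. -/
theorem mem_closure_isDeloneTriangulation (hQ : Q.PosDef) :
    Q ∈ closure {P : Matrix (Fin d) (Fin d) ℝ | P.PosDef ∧ IsDeloneTriangulation (Del P)} := by
  classical
  -- A countable index set. For each F, the matrices violating one chosen dependency form the
  -- complement of a hyperplane, and Baire's theorem makes the intersection dense.
  let I := {F : Finset (Fin d → ℤ) // ∃ β, IsAffineDependency F β ∧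
    ∃ M : Matrix (Fin d) (Fin d) ℝ, ∑ v ∈ F, β v * val M (toReal v) ≠ 0}
  choose β hβ M₀ hM₀ using fun F : I => F.2
  let U : I → Set (Matrix (Fin d) (Fin d) ℝ) := fun F =>
    {M | ∑ v ∈ F.1, β F v * val M (toReal v) ≠ 0}
  have hcont : ∀ F : I, Continuous fun M : Matrix (Fin d) (Fin d) ℝ =>
      ∑ v ∈ F.1, β F v * val M (toReal v) := fun F => by unfold val; fun_prop
  have hopen : ∀ F, IsOpen (U F) := fun F => isOpen_ne_fun (hcont F) continuous_const
  have hdense : ∀ F, Dense (U F) := by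
    intro F M
    by_cases hM : M ∈ U F
    · exact subset_closure hM
    have hM0 : ∑ v ∈ F.1, β F v * val M (toReal v) = 0 := not_not.1 hM
    have hlim : Tendsto (fun t : ℝ => M + t • M₀ F) (𝓝[>] 0) (𝓝 M) := by
      have : Continuous fun t : ℝ => M + t • M₀ F := by fun_prop
      simpa using (this.tendsto 0).mono_left nhdsWithin_le_nhds
    refine mem_closure_of_tendsto hlim ?_
    filter_upwards [self_mem_nhdsWithin] with t ht
    have : ∑ v ∈ F.1, β F v * val (M + t • M₀ F) (toReal v)
        = t * ∑ v ∈ F.1, β F v * val (M₀ F) (toReal v) := by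
      simp_rw [val_form_add, val_form_smul, mul_add, Finset.sum_add_distrib, hM0, zero_add,
        Finset.mul_sum]
      exact Finset.sum_congr rfl fun v _ => by ring
    change _ ≠ _
    rw [this]
    exact mul_ne_zero (ne_of_gt ht) (hM₀ F)
  have : BaireSpace (Matrix (Fin d) (Fin d) ℝ) :=
    inferInstanceAs (BaireSpace (Fin d → Fin d → ℝ))
  have hD := dense_iInter_of_isOpen hopen hdense
  rw [mem_closure_iff_nhds]
  intro N hN
  -- Baire is applied to all matrices; symmetrising does not change the values `val M`, so the
  -- violated dependencies stay violated.
  let σ : Matrix (Fin d) (Fin d) ℝ → Matrix (Fin d) (Fin d) ℝ := fun M =>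
    (1 / 2 : ℝ) • (M + Mᵀ)
  have hσc : Continuous σ := by fun_prop
  have hσQ : σ Q = Q := by
    have h : Qᵀ = Q := hQ.1
    simp only [σ, h, ← two_smul ℝ Q, smul_smul]
    norm_num
  have hσh : ∀ M, (σ M).IsHermitian := fun M => by
    change ((1 / 2 : ℝ) • (M + Mᵀ))ᵀ = _
    simp only [σ, transpose_smul, transpose_add, transpose_transpose, add_comm]
  have hev : ∀ᶠ M in 𝓝 Q, σ M ∈ N ∧ ((σ M).IsHermitian → (σ M).PosDef) := by
    have ht : Tendsto σ (𝓝 Q) (𝓝 Q) := by simpa [hσQ] using hσc.tendsto Q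
    exact ht.eventually (Filter.Eventually.and hN (eventually_posDef hQ))
  obtain ⟨M, hM, hMN, hMp⟩ := hD.inter_nhds_nonempty hev
  have hp := hMp (hσh M)
  refine ⟨σ M, hMN, hp, ⟨σ M, hp, rfl⟩, fun L hL => ?_⟩
  obtain ⟨c, rfl⟩ := (isDelonePolytope_iff hp).1 hL
  by_contra hns
  obtain ⟨u, hu⟩ := nearest_nonempty hp c
  obtain ⟨G, hG, β₁, hβ₁, hne⟩ := exists_dependency_of_not_isSimplex
    (F := (nearest_finite hp c).toFinset) ⟨u, by simpa using hu⟩ (by simpa using hns)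
  let F : I := ⟨G, exists_dependency_val_ne_zero hβ₁ hne⟩
  have h1 := sum_mul_val_eq_zero hp (F := G) (fun v hv => by simpa using hG hv) (hβ F)
  refine Set.mem_iInter.1 hM F (Eq.trans (Finset.sum_congr rfl fun v _ => ?_) h1)
  simp only [σ, val_form_smul, val_form_add, val_transpose]
  ring

/-- Near `Q` there are only forms that share a secondary cone with `Q`, up to closure. -/
theorem eventually_exists_triangulation (hQ : Q.PosDef) :
    ∀ᶠ P in 𝓝[posForms d] Q, ∃ D, IsDeloneTriangulation D ∧ Q ∈ closure (secondaryCone D) ∧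
      P ∈ closure (secondaryCone D) := by
  filter_upwards [eventually_eventually_nhdsWithin.2 (eventually_nearest_subset hQ),
    self_mem_nhdsWithin] with P hP hPp
  have h1 := (eventually_nhdsWithin_iff.1 (hP.and (eventually_nearest_subset hPp)))
  -- A triangulating form R close enough to P refines both P and Q, so its secondary cone serves for
  -- both.
  obtain ⟨R, hR, hRp, hRt⟩ := mem_closure_iff_nhds.1 (mem_closure_isDeloneTriangulation hPp) _ h1
  obtain ⟨h2, h3⟩ := hR hRp
  exact ⟨Del R, hRt, mem_closure_secondaryCone hQ hRp h2, mem_closure_secondaryCone hPp hRp h3⟩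

/-! ### Scaling, and passage to the closure of `W D` -/

lemma inhomMin_pos [NeZero d] (hQ : Q.PosDef) : 0 < inhomMin Q := by
  obtain ⟨v, hv⟩ := nearest_nonempty hQ (fun _ => 1 / 2)
  refine lt_of_lt_of_le (val_pos hQ fun h => ?_) (val_le_inhomMin hQ hv)
  have h0 : (v 0 : ℝ) - 1 / 2 = 0 := congrFun h 0
  have h1 : ((2 * v 0 : ℤ) : ℝ) = ((1 : ℤ) : ℝ) := by
    push_cast
    linarith
  have := Int.cast_injective h1
  omega

lemma homMin_le (hQ : Q.PosDef) {v : Fin d → ℤ} (hv : v ≠ 0) : homMin Q ≤ val Q (toReal v) :=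
  ciInf_le (f := fun v : {v : Fin d → ℤ // v ≠ 0} => val Q (toReal v.1))
    ⟨0, by rintro _ ⟨v, rfl⟩; exact val_nonneg hQ _⟩ ⟨v, hv⟩

lemma homMin_pos [NeZero d] (hQ : Q.PosDef) : 0 < homMin Q := by
  obtain ⟨a, ha, h⟩ := exists_mul_dotProduct_le_val hQ
  have : Nonempty {v : Fin d → ℤ // v ≠ 0} := ⟨⟨fun _ => 1, fun h => one_ne_zero (congrFun h 0)⟩⟩
  refine lt_of_lt_of_le ha (le_ciInf fun v => le_trans ?_ (h _))
  obtain ⟨i, hi⟩ := Function.ne_iff.1 v.2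
  have h1 : toReal v.1 i * toReal v.1 i ≤ toReal v.1 ⬝ᵥ toReal v.1 :=
    Finset.single_le_sum (f := fun i => toReal v.1 i * toReal v.1 i) (fun i _ => mul_self_nonneg _)
      (Finset.mem_univ i)
  have h2 : (1 : ℝ) ≤ toReal v.1 i * toReal v.1 i := by
    have : (1 : ℤ) ≤ v.1 i * v.1 i := Int.add_one_le_iff.2 (mul_self_pos.2 hi)
    simp only [toReal]
    exact_mod_cast this
  nlinarith

lemma del_smul {t : ℝ} (ht : 0 < t) (hQ : Q.PosDef) : Del (t • Q) = Del Q := by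
  have h : ∀ c, nearest (t • Q) c = nearest Q c := fun c => by
    ext v
    simp only [nearest, val_form_smul, Set.mem_ofPred_eq, mul_le_mul_iff_right₀ ht]
  exact (((del_subset_iff (hQ.smul ht) hQ).2 fun a => ⟨a, h a⟩)).antisymm
    ((del_subset_iff hQ (hQ.smul ht)).2 fun a => ⟨a, (h a).symm⟩)

/-- Rescaling to μ = 1 stays in the secondary cone and lands in `W D`; continuity of μ extends this
to the closure. It supplies the test points for the normal cone inequalities. -/
lemma inv_inhomMin_smul_mem_closure_W [NeZero d] {D : Set (Set (Fin d → ℝ))}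
    (hD : IsDeloneTriangulation D) (hQ : Q.PosDef) (hQD : Q ∈ closure (secondaryCone D)) :
    (inhomMin Q)⁻¹ • Q ∈ closure (W D) := by
  have hc : ContinuousWithinAt (fun R => (inhomMin R)⁻¹ • R) (secondaryCone D) Q :=
    (((continuousWithinAt_inhomMin hQ).inv₀ (inhomMin_pos hQ).ne').smul
      continuousWithinAt_id).mono fun R hR => hR.1
  refine closure_mono ?_ (hc.mem_closure_image hQD)
  rintro _ ⟨R, ⟨hR, hRD⟩, rfl⟩
  replace hR : R.PosDef := hR
  have hpos := inhomMin_pos hR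
  have hi : 0 < (inhomMin R)⁻¹ := inv_pos.2 hpos
  refine (mem_W_iff hD ⟨hR.smul hi, (del_smul hi hR).trans hRD⟩).2 ?_
  rw [inhomMin_smul hi.le, inv_mul_cancel₀ hpos.ne']

lemma inhomMin_le_of_mem_closure (hQ : Q.PosDef) {r : ℝ}
    (h : Q ∈ closure {R : Matrix (Fin d) (Fin d) ℝ | R.PosDef ∧ inhomMin R ≤ r}) :
    inhomMin Q ≤ r := by
  have hc : ContinuousWithinAt inhomMin {R : Matrix (Fin d) (Fin d) ℝ | R.PosDef ∧ inhomMin R ≤ r}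
      Q := (continuousWithinAt_inhomMin hQ).mono fun R hR => hR.1
  have : inhomMin '' {R : Matrix (Fin d) (Fin d) ℝ | R.PosDef ∧ inhomMin R ≤ r} ⊆ Set.Iic r := by
    rintro _ ⟨R, hR, rfl⟩
    exact hR.2
  exact closure_minimal this isClosed_Iic (hc.mem_closure_image h)

lemma isHermitian_of_mem_closure_W {D : Set (Set (Fin d → ℝ))} (h : Q ∈ closure (W D)) :
    Q.IsHermitian := by
  have : IsClosed {R : Matrix (Fin d) (Fin d) ℝ | R.IsHermitian} :=
    isClosed_eq (by fun_prop) continuous_id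
  exact closure_minimal (fun R hR => (show R.PosDef from hR.2.1).1) this h

/-- Quasiconvexity on `W D` passes to limits. The combination is assumed positive definite because
limit points of `W D` may be degenerate. -/
lemma inhomMin_segment_le {D : Set (Set (Fin d → ℝ))} (hD : IsDeloneTriangulation D)
    (hA : A ∈ closure (W D)) (hB : B ∈ closure (W D)) {t : ℝ} (ht : 0 < t) (ht1 : t < 1)
    (hP : ((1 - t) • A + t • B).PosDef) : inhomMin ((1 - t) • A + t • B) ≤ 1 := by
  refine inhomMin_le_of_mem_closure hP ?_
  refine map_mem_closure₂ (f := fun A B => (1 - t) • A + t • B) (by fun_prop) hA hB ?_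
  intro A' hA' B' hB'
  have h1 : A'.PosDef := hA'.2.1
  have h2 : B'.PosDef := hB'.2.1
  have h3 : ((1 - t) • A' + t • B').PosDef := (h1.smul (sub_pos.2 ht1)).add (h2.smul ht)
  exact ⟨h3, inhomMin_add_le h1 h2 (hA'.2.2.trans hB'.2.2.symm) (sub_pos.2 ht1).le ht.le (by ring)
    ((mem_W_iff hD hA'.2).1 hA') ((mem_W_iff hD hB'.2).1 hB') h3⟩

/-! ### The lattice covering criterion -/

lemma coveringDensity_le_iff (hA : A.PosDef) :
    coveringDensity Q ≤ coveringDensity A ↔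
      inhomMin Q ^ d / Q.det ≤ inhomMin A ^ d / A.det := by
  have hk : 0 < (MeasureTheory.volume
      (Metric.closedBall (0 : EuclideanSpace ℝ (Fin d)) 1)).toReal :=
    ENNReal.toReal_pos (Metric.measure_closedBall_pos _ _ one_pos).ne'
      MeasureTheory.measure_closedBall_lt_top.ne
  have hA' := hA.det_pos
  have hA0 := inhomMin_nonneg hA
  rw [coveringDensity, coveringDensity, mul_le_mul_iff_left₀ hk,
    Real.sqrt_le_sqrt_iff (by positivity)]

/-- The inequality of arithmetic and geometric means for the determinant. -/
lemma det_le_det_of_trace_le (hQ : Q.PosDef) (hA : A.PosDef) (h : (Q⁻¹ * A).trace ≤ d) :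
    A.det ≤ Q.det := by
  obtain ⟨C, hC⟩ : ∃ C : Matrix (Fin d) (Fin d) ℝ, Q⁻¹ = Cᴴ * C := by
    open scoped MatrixOrder in
    exact CStarAlgebra.nonneg_iff_eq_star_mul_self.1 hQ.inv.posSemidef.nonneg
  have hM : (C * A * Cᴴ).PosSemidef := hA.posSemidef.mul_mul_conjTranspose_same C
  have htr : (C * A * Cᴴ).trace ≤ d := by
    rwa [trace_mul_comm, ← Matrix.mul_assoc, ← hC]
  have hdet : (C * A * Cᴴ).det = A.det / Q.det := by
    have h1 : (Cᴴ * C).det = (Q.det)⁻¹ := by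
      rw [← hC, det_nonsing_inv, Ring.inverse_eq_inv']
    rw [det_mul] at h1
    rw [det_mul, det_mul, div_eq_mul_inv, ← h1]
    ring
  rw [hM.1.trace_eq_sum_eigenvalues] at htr
  rw [hM.1.det_eq_prod_eigenvalues] at hdet
  simp only [RCLike.ofReal_real_eq_id, id] at htr hdet
  -- From x ≤ exp(x − 1): the product is at most exp(trace − d) ≤ 1.
  have h1 : ∏ i, hM.1.eigenvalues i ≤ ∏ i, Real.exp (hM.1.eigenvalues i - 1) :=
    Finset.prod_le_prod (fun i _ => hM.eigenvalues_nonneg i) fun i _ => by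
      linarith [Real.add_one_le_exp (hM.1.eigenvalues i - 1)]
  rw [← Real.exp_sum, Finset.sum_sub_distrib] at h1
  have h2 : Real.exp (∑ i, hM.1.eigenvalues i - ∑ _i : Fin d, (1 : ℝ)) ≤ 1 :=
    Real.exp_le_one_iff.2 (by simpa using htr)
  rw [hdet] at h1
  exact (div_le_one hQ.det_pos).1 (h1.trans h2)

/-- The trace is the derivative of det(1 + tM) at t = 0; the polynomial `p` carries the terms of
order at least two. -/
lemma trace_nonpos_of_eventually_det_le_one (M : Matrix (Fin d) (Fin d) ℝ)
    (h : ∀ᶠ t in 𝓝[>] (0 : ℝ), (1 + t • M).det ≤ 1) : M.trace ≤ 0 := by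
  set p := (det (1 + (Polynomial.X : Polynomial ℝ) • M.map Polynomial.C)).divX.divX
  have hlim : Tendsto (fun t : ℝ => M.trace + p.eval t * t) (𝓝[>] 0) (𝓝 M.trace) := by
    have : Continuous fun t : ℝ => M.trace + p.eval t * t := by fun_prop
    simpa using (this.tendsto 0).mono_left nhdsWithin_le_nhds
  refine le_of_tendsto hlim ?_
  filter_upwards [h, self_mem_nhdsWithin] with t ht ht0
  replace ht0 : 0 < t := ht0
  rw [det_one_add_smul] at ht
  have : (M.trace + p.eval t * t) * t ≤ 0 := by linarith
  exact nonpos_of_mul_nonpos_left this ht0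

lemma inv_mul_self_of_posDef (hQ : Q.PosDef) : Q⁻¹ * Q = 1 :=
  nonsing_inv_mul _ ((isUnit_iff_isUnit_det _).1 hQ.isUnit)

lemma mul_inv_self_of_posDef (hQ : Q.PosDef) : Q * Q⁻¹ = 1 :=
  mul_nonsing_inv _ ((isUnit_iff_isUnit_det _).1 hQ.isUnit)

theorem inv_mem_commonNormals_of_isLocallyOptimalCovering [NeZero d] (hQ : Q.PosDef)
    (hmu : inhomMin Q = 1) (hopt : IsLocallyOptimalCovering Q) : Q⁻¹ ∈ commonNormals Q := by
  refine Set.mem_iInter₂.2 fun D ⟨hD, hQD⟩ => ⟨by simpa [IsSymm] using hQ.inv.1, fun S hS => ?_⟩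
  have hQW : Q ∈ closure (W D) := by
    simpa [hmu] using inv_inhomMin_smul_mem_closure_W hD hQ hQD
  have hS' := isHermitian_of_mem_closure_W hS
  have hseg : Tendsto (fun s : ℝ => (1 - s) • Q + s • S) (𝓝[>] 0) (𝓝[posForms d] Q) :=
    tendsto_nhdsWithin_iff.2 ⟨tendsto_segment Q S, eventually_posDef_segment hQ hS'⟩
  have htr : (Q⁻¹ * S - 1).trace ≤ 0 := by
    refine trace_nonpos_of_eventually_det_le_one _ ?_
    filter_upwards [hseg.eventually hopt, eventually_posDef_segment hQ hS',
      Ioo_mem_nhdsGT one_pos] with t h1 hP ht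
    have hmu' := inhomMin_segment_le hD hQW hS ht.1 ht.2 hP
    rw [coveringDensity_le_iff hP, hmu, one_pow, div_le_div_iff₀ hQ.det_pos hP.det_pos] at h1
    have h2 : inhomMin ((1 - t) • Q + t • S) ^ d ≤ 1 := pow_le_one₀ (inhomMin_nonneg hP) hmu'
    have h3 := mul_le_mul_of_nonneg_right h2 hQ.det_pos.le
    -- Factoring out Q turns det ≤ det Q into a condition on det(1 + tM) with M = Q⁻¹S − 1.
    have h4 : (1 - t) • Q + t • S = Q * (1 + t • (Q⁻¹ * S - 1)) := by
      rw [mul_add, mul_one, Matrix.mul_smul, mul_sub, ← Matrix.mul_assoc,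
        mul_inv_self_of_posDef hQ, one_mul, mul_one, sub_smul, one_smul, smul_sub]
      abel
    rw [h4, det_mul] at h1
    rw [h4] at h3
    refine le_of_mul_le_mul_left ?_ hQ.det_pos
    linarith
  rw [trace_sub, ← inv_mul_self_of_posDef hQ] at htr
  exact sub_nonpos.1 htr

theorem isLocallyOptimalCovering_of_inv_mem_commonNormals [NeZero d] (hQ : Q.PosDef)
    (hmu : inhomMin Q = 1) (h : Q⁻¹ ∈ commonNormals Q) : IsLocallyOptimalCovering Q := by
  filter_upwards [eventually_exists_triangulation hQ, self_mem_nhdsWithin]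
    with P ⟨D, hD, hQD, hPD⟩ hP
  replace hP : P.PosDef := hP
  have hpos := inhomMin_pos hP
  have h1 := (Set.mem_iInter₂.1 h D ⟨hD, hQD⟩).2 _ (inv_inhomMin_smul_mem_closure_W hD hP hPD)
  have h2 : (Q⁻¹ * ((inhomMin P)⁻¹ • P)).trace ≤ d := by
    refine h1.trans_eq ?_
    rw [ip, inv_mul_self_of_posDef hQ, trace_one, Fintype.card_fin]
  have h3 := det_le_det_of_trace_le hQ (hP.smul (inv_pos.2 hpos)) h2
  rw [coveringDensity_le_iff hP, hmu, one_pow, div_le_div_iff₀ hQ.det_pos hP.det_pos]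
  rw [det_smul, Fintype.card_fin, inv_pow, inv_mul_le_iff₀ (by positivity)] at h3
  linarith

lemma mem_cone_singleton {N : Matrix (Fin d) (Fin d) ℝ} :
    N ∈ cone {A} ↔ ∃ t : ℝ, 0 ≤ t ∧ N = t • A := by
  constructor
  · intro h
    obtain ⟨t, rfl⟩ := Submodule.mem_span_singleton.1 h
    exact ⟨t, t.2, rfl⟩
  · rintro ⟨t, ht, rfl⟩
    exact Submodule.mem_span_singleton.2 ⟨⟨t, ht⟩, rfl⟩

lemma ip_smul (t : ℝ) (A B : Matrix (Fin d) (Fin d) ℝ) : ip (t • A) B = t * ip A B := by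
  simp [ip]

lemma smul_mem_commonNormals_iff {t : ℝ} (ht : 0 < t) :
    t • A ∈ commonNormals Q ↔ A ∈ commonNormals Q := by
  simp only [commonNormals, deloneNormalCone, normalCone, Set.mem_iInter, Set.mem_ofPred_eq, ip_smul,
    mul_le_mul_iff_right₀ ht, IsSymm, transpose_smul, smul_right_inj ht.ne']

theorem isLocallyOptimalCovering_iff [NeZero d] (hQ : Q.PosDef) (hmu : inhomMin Q = 1) :
    IsLocallyOptimalCovering Q ↔ ∃ N ∈ cone {Q⁻¹} ∩ commonNormals Q, N ≠ 0 := by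
  constructor
  · intro h
    refine ⟨Q⁻¹, ⟨mem_cone_singleton.2 ⟨1, zero_le_one, (one_smul _ _).symm⟩,
      inv_mem_commonNormals_of_isLocallyOptimalCovering hQ hmu h⟩, fun h0 => ?_⟩
    have := hQ.inv.det_pos
    rw [h0, det_zero] at this
    exact lt_irrefl _ this
  · rintro ⟨N, ⟨hN, hN'⟩, hne⟩
    obtain ⟨t, ht, rfl⟩ := mem_cone_singleton.1 hN
    have ht' : 0 < t := ht.lt_of_ne (by rintro rfl; simp at hne)
    exact isLocallyOptimalCovering_of_inv_mem_commonNormals hQ hmu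
      ((smul_mem_commonNormals_iff ht').1 hN')

/-! ### The packing-covering criterion -/

lemma ip_vecForm (A : Matrix (Fin d) (Fin d) ℝ) (v : Fin d → ℤ) :
    ip A (vecForm v) = val A (toReal v) := by
  rw [ip, vecForm, mul_vecMulVec, trace_vecMulVec, val, dotProduct_comm]

lemma ip_comm (A B : Matrix (Fin d) (Fin d) ℝ) : ip A B = ip B A := trace_mul_comm _ _

/-- A conic combination of minimal vectors of `Q` has a total weight, which bounds its inner
products with other forms. -/
lemma exists_weight_of_mem_cone {N : Matrix (Fin d) (Fin d) ℝ}
    (hN : N ∈ cone {V | ∃ v : Fin d → ℤ, v ≠ 0 ∧ ip Q (vecForm v) = homMin Q ∧ V = vecForm v}) :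
    ∃ s : ℝ, 0 ≤ s ∧ (s = 0 → N = 0) ∧ ip N Q = s * homMin Q ∧
      ∀ P : Matrix (Fin d) (Fin d) ℝ, P.PosDef → s * homMin P ≤ ip N P := by
  induction hN using Submodule.span_induction with
  | mem V hV =>
    obtain ⟨v, hv, hQv, rfl⟩ := hV
    refine ⟨1, zero_le_one, fun h => absurd h one_ne_zero, ?_, fun P hP => ?_⟩
    · rw [ip_comm, hQv, one_mul]
    · rw [ip_comm, ip_vecForm, one_mul]
      exact homMin_le hP hv
  | zero => exact ⟨0, le_rfl, fun _ => rfl, by simp [ip], by simp [ip]⟩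
  | add A B _ _ hA hB =>
    obtain ⟨s, hs, hs0, hsQ, hsP⟩ := hA
    obtain ⟨t, ht, ht0, htQ, htP⟩ := hB
    have hadd : ∀ P, ip (A + B) P = ip A P + ip B P := fun P => by simp [ip, add_mul]
    refine ⟨s + t, add_nonneg hs ht, fun h => ?_, ?_, fun P hP => ?_⟩
    · rw [hs0 (by linarith), ht0 (by linarith), add_zero]
    · rw [hadd, hsQ, htQ, add_mul]
    · rw [hadd, add_mul]
      exact add_le_add (hsP P hP) (htP P hP)
  | smul c A _ hA =>
    obtain ⟨s, hs, hs0, hsQ, hsP⟩ := hA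
    have hsm : ∀ P, ip (c • A) P = c * ip A P := fun P => ip_smul (c : ℝ) A P
    refine ⟨c * s, mul_nonneg c.2 hs, fun h => ?_, ?_, fun P hP => ?_⟩
    · rcases mul_eq_zero.1 h with h | h
      · rw [show c = 0 from Subtype.ext h, zero_smul]
      · rw [hs0 h, smul_zero]
    · rw [hsm, hsQ, mul_assoc]
    · rw [hsm, mul_assoc]
      exact mul_le_mul_of_nonneg_left (hsP P hP) c.2

/-- For P near Q: sλ(P) ≤ ⟨N, P⟩ ≤ μ(P)⟨N, Q⟩ = μ(P)sλ(Q), and s > 0 can be cancelled. -/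
theorem isLocallyOptimalPackingCovering_of_mem [NeZero d] (hQ : Q.PosDef) (hmu : inhomMin Q = 1)
    {N : Matrix (Fin d) (Fin d) ℝ}
    (hN : N ∈ cone {V | ∃ v : Fin d → ℤ, v ≠ 0 ∧ ip Q (vecForm v) = homMin Q ∧ V = vecForm v})
    (hN' : N ∈ commonNormals Q) (hne : N ≠ 0) : IsLocallyOptimalPackingCovering Q := by
  obtain ⟨s, hs, hs0, hsQ, hsP⟩ := exists_weight_of_mem_cone hN
  have hs' : 0 < s := hs.lt_of_ne fun h => hne (hs0 h.symm)
  filter_upwards [eventually_exists_triangulation hQ, self_mem_nhdsWithin]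
    with P ⟨D, hD, hQD, hPD⟩ hP
  replace hP : P.PosDef := hP
  have hpos := inhomMin_pos hP
  have h1 := (Set.mem_iInter₂.1 hN' D ⟨hD, hQD⟩).2 _ (inv_inhomMin_smul_mem_closure_W hD hP hPD)
  rw [ip_comm, ip_smul, ip_comm, hsQ, inv_mul_le_iff₀ hpos] at h1
  have h2 : homMin P ≤ inhomMin P * homMin Q := by
    refine le_of_mul_le_mul_left ?_ hs'
    linarith [hsP P hP]
  refine mul_le_mul_of_nonneg_left (Real.sqrt_le_sqrt ?_) zero_le_two
  rw [hmu, div_le_div_iff₀ (homMin_pos hQ) (homMin_pos hP), one_mul]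
  exact h2

end PQF

theorem mainTheorem12 (d : ℕ) (Q : Matrix (Fin d) (Fin d) ℝ) (hQ : Q ∈ PQF.posForms d)
    (hmu : PQF.inhomMin Q = 1) :
    (PQF.IsLocallyOptimalCovering Q ↔
      ∃ N ∈ PQF.cone {Q⁻¹} ∩ PQF.commonNormals Q, N ≠ 0) ∧
    ((∃ N ∈ PQF.cone {V | ∃ v : Fin d → ℤ, v ≠ 0 ∧ PQF.ip Q (PQF.vecForm v) = PQF.homMin Q ∧
          V = PQF.vecForm v} ∩ PQF.commonNormals Q, N ≠ 0) →
      PQF.IsLocallyOptimalPackingCovering Q) := by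
  -- In dimension 0 one has μ = 0, against μ(Q) = 1.
  have hd : NeZero d := ⟨by
    rintro rfl
    simp [PQF.inhomMin, PQF.val] at hmu⟩
  exact ⟨PQF.isLocallyOptimalCovering_iff hQ hmu, fun ⟨N, ⟨hN, hN'⟩, hne⟩ =>
    PQF.isLocallyOptimalPackingCovering_of_mem hQ hmu hN hN' hne⟩
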